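/- Let $m\ge 0$ and let $H_0=-\mathrm i\,\sigma_1\frac{d}{dx}+m\sigma_3$, with $\sigma_1=\begin{pmatrix}0&1\\1&0\end{pmatrix}$, $\sigma_3=\begin{pmatrix}1&0\\0&-1\end{pmatrix}$, be the free Dirac operator in $L^2(\mathbb R)\otimes\mathbb C^2$ with domain $H^1(\mathbb R)\otimes\mathbb C^2$. Let $V=(V_{ij})_{i,j=1}^2$ be a (not necessarily Hermitian) matrix-valued function on $\mathbb R$ with $V_{ij}\in L^1(\mathbb R)+L^\infty_0(\mathbb R)$, where $L^\infty_0(\mathbb R)$ is the space of bounded functions that vanish at infinity, and let $\|V(x)\|$ be the operator norm of $V(x)$ on Euclidean $\mathbb C^2$. Write $V=BA$ with the multiplication operators $A=|V|^{1/2}$ and $B=U|V|^{1/2}$, where $V=U|V|$ is the pointwise polar decomposition, and put $R_0(z)=(H_0-z)^{-1}$, $Q(z)=\overline{AR_0(z)B}$. Let $H$ be the closed extension of $H_0+V$ whose resolvent is $$(H-z)^{-1}=R_0(z)-\overline{R_0(z)B}\,(I+Q(z))^{-1}AR_0(z)$$ at points $z\in\rho(H_0)$ with $-1\in\rho(Q(z))$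 (such points exist, and one of them determines $H$; if $V$ is bounded, then $H=H_0+V$). Its spectrum is denoted by $\sigma(H)$. Set $$F_V(s):=\sup_{y\in\mathbb R}\int_{\mathbb R}\|V(x)\|\,e^{-s|x-y|}\,dx\in[0,\infty],\qquad \Phi(z):=\frac{z+m}{z-m},\qquad \eta(s):=\sqrt{\tfrac12+\tfrac14(s+s^{-1})}\quad(s>0).$$ (i) Let $z\in\mathbb C\setminus\big((-\infty,-m]\cup[m,\infty)\big)$, and let $\sqrt{z^2-m^2}$ be the square root with positive imaginary part. If $$\eta(|\Phi(z)|)\,F_V\big(\operatorname{Im}\sqrt{z^2-m^2}\big)<1,$$ then $z\notin\sigma(H)$. (ii) If the equation $F_V(\mu)=\mu/m$ has a solution $\mu_0\in(-m,m)$, then it is the only real solution, and $$\sigma(H)\cap\Big(-\sqrt{m^2-\mu_0^2},\ \sqrt{m^2-\mu_0^2}\Big)=\emptyset .$$ -/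

import Mathlib

open MeasureTheory Set
open scoped ENNReal ContDiff

noncomputable section

namespace DiracSpectrum

/-! ### Unbounded operators -/

section Operators

variable {E F G : Type*}
  [NormedAddCommGroup E] [NormedSpace ℂ E]
  [NormedAddCommGroup F] [NormedSpace ℂ F]
  [NormedAddCommGroup G] [NormedSpace ℂ G]

/-- A bounded everywhere defined operator, regarded as a partially defined one. -/
def everywhere (S : E →L[ℂ] F) : E →ₗ.[ℂ] F := (S : E →ₗ[ℂ] F).toPMap ⊤

/-- The product `T S` of unbounded operators on its natural domain
`{f ∈ dom S : S f ∈ dom T}`. -/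
def prodOp (T : F →ₗ.[ℂ] G) (S : E →ₗ.[ℂ] F) : E →ₗ.[ℂ] G where
  domain := (T.domain.comap S.toFun).map S.domain.subtype
  toFun :=
    { toFun := fun f =>
        T ⟨S ⟨f, by
            obtain ⟨f, hf⟩ := f
            obtain ⟨g, -, rfl⟩ := hf
            exact g.2⟩, by
          obtain ⟨f, hf⟩ := f
          obtain ⟨g, hg, rfl⟩ := hf
          exact hg⟩
      map_add' := fun f g => by
        rw [← LinearPMap.map_add]
        congr 1
        apply Subtype.ext
        change S _ = S _ + S _
        rw [← LinearPMap.map_add]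
        rfl
      map_smul' := fun c f => by
        rw [RingHom.id_apply, ← LinearPMap.map_smul]
        congr 1
        apply Subtype.ext
        change S _ = c • S _
        rw [← LinearPMap.map_smul]
        rfl }

/-- `S` is the resolvent `(T - z)⁻¹`: a bounded everywhere defined two-sided inverse of
`T - z : dom T → E`. -/
def IsResolventAt (T : E →ₗ.[ℂ] E) (z : ℂ) (S : E →L[ℂ] E) : Prop :=
  (∀ f : T.domain, S (T f - z • (f : E)) = f) ∧
    ∀ g : E, ∃ f : T.domain, (f : E) = S g ∧ T f - z • (f : E) = g

/-- The resolvent set of an unbounded operator. -/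
def rho (T : E →ₗ.[ℂ] E) : Set ℂ := {z | ∃ S : E →L[ℂ] E, IsResolventAt T z S}

/-- The spectrum of an unbounded operator. -/
def sigma (T : E →ₗ.[ℂ] E) : Set ℂ := (rho T)ᶜ

/-- `R` is given at the point `z ∈ ρ(H₀)` by the resolvent formula
`R = R₀(z) - cl(R₀(z) B) (1 + Q)⁻¹ A R₀(z)`, `Q = cl(A R₀(z) B)`, where `R₀(z) = (H₀ - z)⁻¹`,
`A R₀(z)` is everywhere defined and bounded, `R₀(z) B` and `A R₀(z) B` have bounded
everywhere defined closures, and `-1 ∈ ρ(Q)`. -/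
def IsPerturbedResolvent (H₀ : E →ₗ.[ℂ] E) (A : E →ₗ.[ℂ] F) (B : F →ₗ.[ℂ] E)
    (z : ℂ) (R : E →L[ℂ] E) : Prop :=
  ∃ (R₀ : E →L[ℂ] E) (AR : E →L[ℂ] F) (RB : F →L[ℂ] E) (Q : F →L[ℂ] F),
    IsResolventAt H₀ z R₀ ∧
    prodOp A (everywhere R₀) = everywhere AR ∧
    (prodOp (everywhere R₀) B).closure = everywhere RB ∧
    (prodOp A (prodOp (everywhere R₀) B)).closure = everywhere Q ∧
    (-1 : ℂ) ∈ resolventSet ℂ Q ∧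
    R = R₀ - RB ∘L Ring.inverse (1 + Q) ∘L AR

open Classical in
/-- The closed extension `H` of `H₀ + B A` that is defined through its resolvent
`R(z₀) = R₀(z₀) - cl(R₀(z₀) B) (1 + Q(z₀))⁻¹ A R₀(z₀)` at a point `z₀ ∈ ρ(H₀)` with
`-1 ∈ ρ(Q(z₀))`, that is, `H = z₀ + R(z₀)⁻¹`. By the resolvent identity the choice of `z₀` is
immaterial. If there is no such point, the value is the operator sum `H₀ + B A`. -/
def perturbedOp (H₀ : E →ₗ.[ℂ] E) (A : E →ₗ.[ℂ] F) (B : F →ₗ.[ℂ] E) : E →ₗ.[ℂ] E :=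
  if h : ∃ p : ℂ × (E →L[ℂ] E), IsPerturbedResolvent H₀ A B p.1 p.2 then
    (h.choose.1 • (LinearMap.id : E →ₗ[ℂ] E)) +ᵥ (everywhere h.choose.2).inverse
  else H₀ + prodOp B A

end Operators

/-! ### The free Dirac operator -/

/-- `ℂ²` with the Euclidean norm. -/
abbrev Spinor : Type := EuclideanSpace ℂ (Fin 2)

/-- The Hilbert space `L²(ℝ) ⊗ ℂ² = L²(ℝ; ℂ²)`. -/
abbrev StateSpace : Type := Lp Spinor 2 (volume : Measure ℝ)

/-- `g` is the weak derivative of `f`. -/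
def HasWeakDeriv (f g : StateSpace) : Prop :=
  ∀ φ : ℝ → ℝ, ContDiff ℝ ∞ φ → HasCompactSupport φ →
    ∫ x, deriv φ x • (f : ℝ → Spinor) x = -∫ x, φ x • (g : ℝ → Spinor) x

lemma integrable_test_smul {φ : ℝ → ℝ} (hφ : Continuous φ) (hc : HasCompactSupport φ)
    (f : StateSpace) : Integrable (fun x => φ x • (f : ℝ → Spinor) x) :=
  ((Lp.memLp f).locallyIntegrable (by norm_num)).integrable_smul_left_of_hasCompactSupport hφ hc

/-- The graph of the weak derivative in `L²(ℝ; ℂ²)`. -/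
def weakDerivGraph : Submodule ℂ (StateSpace × StateSpace) where
  carrier := {p | HasWeakDeriv p.1 p.2}
  zero_mem' := fun φ _ _ => by
    have h : ((0 : StateSpace) : ℝ → Spinor) =ᵐ[volume] 0 := Lp.coeFn_zero _ _ _
    have h1 : (fun x => deriv φ x • ((0 : StateSpace) : ℝ → Spinor) x) =ᵐ[volume] 0 := by
      filter_upwards [h] with x hx
      simp
    have h2 : (fun x => φ x • ((0 : StateSpace) : ℝ → Spinor) x) =ᵐ[volume] 0 := by
      filter_upwards [h] with x hx
      simp
    change ∫ x, deriv φ x • ((0 : StateSpace) : ℝ → Spinor) x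
      = -∫ x, φ x • ((0 : StateSpace) : ℝ → Spinor) x
    rw [integral_congr_ae h1, integral_congr_ae h2]
    simp
  add_mem' := by
    rintro ⟨f, g⟩ ⟨f', g'⟩ h h' φ hφ hc
    have hd : Continuous (deriv φ) := hφ.continuous_deriv (by simp)
    have e1 : (fun x => deriv φ x • ((f + f' : StateSpace) : ℝ → Spinor) x) =ᵐ[volume]
        fun x => deriv φ x • (f : ℝ → Spinor) x + deriv φ x • (f' : ℝ → Spinor) x := by
      filter_upwards [Lp.coeFn_add f f'] with x hx
      rw [hx, Pi.add_apply, smul_add]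
    have e2 : (fun x => φ x • ((g + g' : StateSpace) : ℝ → Spinor) x) =ᵐ[volume]
        fun x => φ x • (g : ℝ → Spinor) x + φ x • (g' : ℝ → Spinor) x := by
      filter_upwards [Lp.coeFn_add g g'] with x hx
      rw [hx, Pi.add_apply, smul_add]
    change ∫ x, deriv φ x • ((f + f' : StateSpace) : ℝ → Spinor) x
      = -∫ x, φ x • ((g + g' : StateSpace) : ℝ → Spinor) x
    rw [integral_congr_ae e1, integral_congr_ae e2,
      integral_add (integrable_test_smul hd hc.deriv f) (integrable_test_smul hd hc.deriv f'),
      integral_add (integrable_test_smul hφ.continuous hc g)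
        (integrable_test_smul hφ.continuous hc g'), h φ hφ hc, h' φ hφ hc, neg_add]
  smul_mem' := by
    rintro c ⟨f, g⟩ h φ hφ hc
    have e1 : (fun x => deriv φ x • ((c • f : StateSpace) : ℝ → Spinor) x) =ᵐ[volume]
        fun x => c • (deriv φ x • (f : ℝ → Spinor) x) := by
      filter_upwards [Lp.coeFn_smul c f] with x hx
      rw [hx, Pi.smul_apply, smul_comm]
    have e2 : (fun x => φ x • ((c • g : StateSpace) : ℝ → Spinor) x) =ᵐ[volume]
        fun x => c • (φ x • (g : ℝ → Spinor) x) := by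
      filter_upwards [Lp.coeFn_smul c g] with x hx
      rw [hx, Pi.smul_apply, smul_comm]
    change ∫ x, deriv φ x • ((c • f : StateSpace) : ℝ → Spinor) x
      = -∫ x, φ x • ((c • g : StateSpace) : ℝ → Spinor) x
    rw [integral_congr_ae e1, integral_congr_ae e2, integral_smul, integral_smul, h φ hφ hc,
      smul_neg]

/-- Weak derivatives are unique. -/
lemma weakDerivGraph_functional (p : StateSpace × StateSpace) (hp : p ∈ weakDerivGraph)
    (h0 : p.1 = 0) : p.2 = 0 := by
  obtain ⟨f, g⟩ := p
  obtain rfl : f = 0 := h0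
  have hloc : LocallyIntegrable (g : ℝ → Spinor) volume :=
    (Lp.memLp g).locallyIntegrable (by norm_num)
  have key : ∀ᵐ x ∂(volume : Measure ℝ), (g : ℝ → Spinor) x = 0 := by
    apply ae_eq_zero_of_integral_contDiff_smul_eq_zero hloc
    intro φ hφ hc
    have h : ∫ x, deriv φ x • ((0 : StateSpace) : ℝ → Spinor) x
      = -∫ x, φ x • (g : ℝ → Spinor) x := hp φ hφ hc
    have h1 : (fun x => deriv φ x • ((0 : StateSpace) : ℝ → Spinor) x) =ᵐ[volume] 0 := by
      filter_upwards [Lp.coeFn_zero Spinor 2 (volume : Measure ℝ)] with x hx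
      simp
    rw [integral_congr_ae h1] at h
    simpa using h.symm
  exact (Lp.eq_zero_iff_ae_eq_zero).2 key

/-- `d/dx` on the Sobolev space `H¹(ℝ; ℂ²)`. -/
def weakDeriv : StateSpace →ₗ.[ℂ] StateSpace := weakDerivGraph.toLinearPMap

lemma mem_graph_weakDeriv (f g : StateSpace) : (f, g) ∈ weakDeriv.graph ↔ HasWeakDeriv f g := by
  rw [weakDeriv, Submodule.toLinearPMap_graph_eq _ weakDerivGraph_functional]
  rfl

/-- A `2 × 2` matrix as a bounded operator on Euclidean `ℂ²`; its norm is the operator norm. -/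
def matOp (M : Matrix (Fin 2) (Fin 2) ℂ) : Spinor →L[ℂ] Spinor :=
  Matrix.toEuclideanCLM (n := Fin 2) (𝕜 := ℂ) M

/-- The action of a constant `2 × 2` matrix on `L²(ℝ; ℂ²)`. -/
def constOp (M : Matrix (Fin 2) (Fin 2) ℂ) : StateSpace →ₗ[ℂ] StateSpace :=
  ((matOp M).compLpL 2 (volume : Measure ℝ) : StateSpace →L[ℂ] StateSpace)

/-- The free Dirac operator `H₀ = -i σ₁ d/dx + m σ₃` with domain `H¹(ℝ; ℂ²)`. -/
def freeDirac (m : ℝ) : StateSpace →ₗ.[ℂ] StateSpace :=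
  (constOp ((m : ℂ) • !![1, 0; 0, -1])) +ᵥ
    (constOp ((-Complex.I) • !![0, 1; 1, 0])).compPMap weakDeriv

/-! ### The perturbed Dirac operator -/

/-- The domain `{f ∈ L² : M f ∈ L²}` of the multiplication operator by `M`. -/
def mulDomain (M : ℝ → Spinor →L[ℂ] Spinor) : Submodule ℂ StateSpace where
  carrier := {f | MemLp (fun x => M x ((f : ℝ → Spinor) x)) 2 volume}
  zero_mem' := by
    refine (MemLp.zero (p := 2) (μ := (volume : Measure ℝ)) (ε := Spinor)).ae_eq ?_
    filter_upwards [Lp.coeFn_zero Spinor 2 (volume : Measure ℝ)] with x hx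
    rw [hx, Pi.zero_apply, map_zero]
  add_mem' := by
    intro f g hf hg
    refine (MemLp.add hf hg).ae_eq ?_
    filter_upwards [Lp.coeFn_add f g] with x hx
    rw [hx, Pi.add_apply, Pi.add_apply, map_add]
  smul_mem' := by
    intro c f hf
    refine (MemLp.const_smul hf c).ae_eq ?_
    filter_upwards [Lp.coeFn_smul c f] with x hx
    rw [hx, Pi.smul_apply, Pi.smul_apply, map_smul]

lemma memLp_of_mem_mulDomain {M : ℝ → Spinor →L[ℂ] Spinor} {f : StateSpace}
    (hf : f ∈ mulDomain M) : MemLp (fun x => M x ((f : ℝ → Spinor) x)) 2 volume := hf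

/-- The maximal multiplication operator by an operator-valued function on `L²(ℝ; ℂ²)`. -/
def mulOp (M : ℝ → Spinor →L[ℂ] Spinor) : StateSpace →ₗ.[ℂ] StateSpace where
  domain := mulDomain M
  toFun :=
    { toFun := fun f =>
        MemLp.toLp (fun x => M x (((f : StateSpace) : ℝ → Spinor) x)) (memLp_of_mem_mulDomain f.2)
      map_add' := by
        intro f g
        rw [← MemLp.toLp_add]
        refine MemLp.toLp_congr _ _ ?_
        filter_upwards [Lp.coeFn_add (f : StateSpace) (g : StateSpace)] with x hx
        rw [Submodule.coe_add, hx, Pi.add_apply, Pi.add_apply, map_add]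
      map_smul' := by
        intro c f
        rw [RingHom.id_apply, ← MemLp.toLp_const_smul]
        refine MemLp.toLp_congr _ _ ?_
        filter_upwards [Lp.coeFn_smul c (f : StateSpace)] with x hx
        rw [Submodule.coe_smul, hx, Pi.smul_apply, Pi.smul_apply, map_smul] }

/-- `|T|^{1/2}`, where `|T| = (T* T)^{1/2}`. -/
def sqrtAbs (T : Spinor →L[ℂ] Spinor) : Spinor →L[ℂ] Spinor := CFC.sqrt (CFC.abs T)

/-- The partial isometry `U` in the polar decomposition `T = U |T|`: it is `T |T|⁻¹` on the range
of `|T|` and `0` on the kernel of `T` (recall `0⁻¹ = 0`). -/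
def polarPart (T : Spinor →L[ℂ] Spinor) : Spinor →L[ℂ] Spinor :=
  T * cfc (fun t : ℝ => t⁻¹) (CFC.abs T)

/-- The Dirac operator `H`: the closed extension of `H₀ + V` that belongs to the factorization
`V = B A` with `A = |V|^{1/2}`, `B = U |V|^{1/2}`, where `V = U |V|` is the polar decomposition. -/
def diracOp (m : ℝ) (V : ℝ → Matrix (Fin 2) (Fin 2) ℂ) : StateSpace →ₗ.[ℂ] StateSpace :=
  perturbedOp (freeDirac m)
    (mulOp fun x => sqrtAbs (matOp (V x)))
    (mulOp fun x => polarPart (matOp (V x)) * sqrtAbs (matOp (V x)))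

/-! ### The quantities in the spectral estimate -/

/-- `L^∞_0(ℝ)`: bounded functions that vanish at infinity. -/
def MemLinftyZero (f : ℝ → ℂ) : Prop :=
  MemLp f ∞ volume ∧ ∀ ε : ℝ, 0 < ε → ∃ r : ℝ, ∀ᵐ x ∂volume, r < |x| → ‖f x‖ ≤ ε

/-- `L¹(ℝ) + L^∞_0(ℝ)`. -/
def MemL1AddLinftyZero (f : ℝ → ℂ) : Prop :=
  ∃ w g : ℝ → ℂ, Integrable w volume ∧ MemLinftyZero g ∧ f =ᵐ[volume] w + g

/-- `F_V(s) = sup_y ∫ ‖V(x)‖ e^{-s |x - y|} dx`. -/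
def FV (V : ℝ → Matrix (Fin 2) (Fin 2) ℂ) (s : ℝ) : ℝ≥0∞ :=
  ⨆ y : ℝ, ∫⁻ x : ℝ, ‖matOp (V x)‖ₑ * ENNReal.ofReal (Real.exp (-s * |x - y|))

/-- `Φ(z) = (z + m) / (z - m)`. -/
def Phi (m : ℝ) (z : ℂ) : ℂ := (z + m) / (z - m)

/-- `η(s) = (1/2 + (s + s⁻¹)/4)^{1/2}`. -/
def eta (s : ℝ) : ℝ := Real.sqrt (1 / 2 + (s + s⁻¹) / 4)

/-- The branch of the square root on `ℂ \ [0, ∞)` with positive imaginary part. -/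
def sqrtUpper (w : ℂ) : ℂ := Complex.I * (-w) ^ (1 / 2 : ℂ)

lemma sqrtUpper_sq (w : ℂ) : sqrtUpper w ^ 2 = w := by
  rw [sqrtUpper, mul_pow, Complex.I_sq, one_div, Complex.cpow_ofNat_inv_pow]
  ring

lemma sqrtUpper_im_pos {w : ℂ} (hw : ∀ t : ℝ, 0 ≤ t → w ≠ t) : 0 < (sqrtUpper w).im := by
  have h0 : -w ≠ 0 := by
    intro h
    exact hw 0 le_rfl (by simpa using h)
  have hpi : (-w).arg ≠ Real.pi := by
    intro h
    rw [Complex.arg_eq_pi_iff] at h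
    obtain ⟨h1, h2⟩ := h
    simp only [Complex.neg_re, Complex.neg_im] at h1 h2
    refine hw w.re (by linarith) (Complex.ext (by simp) ?_)
    simp only [Complex.ofReal_im]
    linarith
  have e : (sqrtUpper w).im = ((-w) ^ (1 / 2 : ℂ)).re := by
    simp [sqrtUpper]
  have e' : (1 / 2 : ℂ) = ((1 / 2 : ℝ) : ℂ) := by norm_num
  rw [e, Complex.cpow_def_of_ne_zero h0, e', Complex.exp_re]
  refine mul_pos (Real.exp_pos _) (Real.cos_pos_of_mem_Ioo ?_)
  have h1 := Complex.neg_pi_lt_arg (-w)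
  have h2 := lt_of_le_of_ne (Complex.arg_le_pi (-w)) hpi
  rw [Complex.im_mul_ofReal, Complex.log_im]
  constructor <;> linarith

/-- `(-∞, -m] ∪ [m, ∞)` as a subset of `ℂ`. -/
def freeSpectrum (m : ℝ) : Set ℂ := Complex.ofReal '' (Iic (-m) ∪ Ici m)

end DiracSpectrum

end

open MeasureTheory Set Filter Topology
open scoped ENNReal ContDiff NNReal

noncomputable section

namespace DiracSpectrum

/-! ### Unbounded operators and their graphs -/

section OperatorLemmas

variable {E F G : Type*}
  [NormedAddCommGroup E] [NormedSpace ℂ E]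
  [NormedAddCommGroup F] [NormedSpace ℂ F]
  [NormedAddCommGroup G] [NormedSpace ℂ G]

/-! The argument is of Birman–Schwinger type: as soon as `‖Q(z)‖ < 1`, the operator `1 + Q(z)` is
invertible, the resolvent formula makes sense at `z`, and `z` lies in the resolvent set of `H`.

The norm of `Q(z)` is read off from the Green kernel. With `k = √(z² - m²)`, `Im k > 0`, the free
resolvent is convolution with `N(t) = e^{ik|t|} G_±`, where the constant matrices `G_±` have rank
one and norm at most `η(|Φ(z)|)` (`norm_greenMatrix_le`). Since `‖A‖² = ‖V‖` and `‖B‖² ≤ ‖V‖`,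
Cauchy–Schwarz and Tonelli (`IsExpKernel.lintegral_kerInt_le`) bound the operator with kernel `A(x)
N(x - y) B(y)` by `η(|Φ(z)|) F_V(Im k)`. That `N` does give the resolvent is checked weakly in
`hasWeakDeriv_greenKernel`; uniqueness comes from `eq_zero_of_hasWeakDeriv`.

`H` is defined through one point `w`, perhaps different from `z`. The first resolvent identity,
which the formula inherits from `R₀`, carries the resolvent from `w` to `z` (`mem_rho_perturbedOp`).

For real `z = x` in the gap, put `s = √(m² - x²)`. Then `η(|Φ(x)|) = m/s` and `Im k = s`, so the
criterion reads `F_V(s) < s/m`. As `F_V` is nonincreasing and `s/m` is strictly increasing, a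
crossing point `μ₀` is unique and the criterion holds for all `s > μ₀`. -/

lemma mem_graph_everywhere (S : E →L[ℂ] F) (f : E) (g : F) :
    (f, g) ∈ (everywhere S).graph ↔ S f = g := by
  rw [LinearPMap.mem_graph_iff]
  constructor
  · rintro ⟨y, rfl, h⟩
    exact h
  · intro h
    exact ⟨⟨f, Submodule.mem_top⟩, rfl, h⟩

lemma mem_graph_prodOp (T : F →ₗ.[ℂ] G) (S : E →ₗ.[ℂ] F) (f : E) (h : G) :
    (f, h) ∈ (prodOp T S).graph ↔ ∃ g, (f, g) ∈ S.graph ∧ (g, h) ∈ T.graph := by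
  constructor
  · intro hf
    rw [LinearPMap.mem_graph_iff] at hf
    obtain ⟨⟨_, ⟨f', hf', rfl⟩⟩, rfl, rfl⟩ := hf
    exact ⟨S f', S.mem_graph f', T.mem_graph ⟨S f', hf'⟩⟩
  · rintro ⟨g, hfg, hgh⟩
    rw [LinearPMap.mem_graph_iff] at hfg hgh
    obtain ⟨f', rfl, rfl⟩ := hfg
    obtain ⟨g', hg', rfl⟩ := hgh
    replace hg' : (g' : F) = S f' := hg'
    rw [LinearPMap.mem_graph_iff]
    refine ⟨⟨f', ⟨f', ?_, rfl⟩⟩, rfl, ?_⟩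
    · change S f' ∈ T.domain
      rw [← hg']
      exact g'.2
    · change T _ = T _
      congr 1
      exact Subtype.ext hg'.symm

lemma mem_domain_iff_mem_graph (T : E →ₗ.[ℂ] F) (f : E) :
    f ∈ T.domain ↔ ∃ g, (f, g) ∈ T.graph := by
  simp [LinearPMap.mem_graph_iff]

lemma isResolventAt_iff_graph (T : E →ₗ.[ℂ] E) (z : ℂ) (S : E →L[ℂ] E) :
    IsResolventAt T z S ↔
      (∀ f h, (f, h) ∈ T.graph → S (h - z • f) = f) ∧ ∀ g, (S g, g + z • S g) ∈ T.graph := by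
  refine and_congr ⟨fun H f h hf => ?_, fun H f => H _ _ (T.mem_graph f)⟩
    ⟨fun H g => ?_, fun H g => ?_⟩
  · rw [LinearPMap.mem_graph_iff] at hf
    obtain ⟨f', rfl, rfl⟩ := hf
    exact H f'
  · obtain ⟨f, h1, h2⟩ := H g
    rw [LinearPMap.mem_graph_iff]
    refine ⟨f, h1, ?_⟩
    rw [← h1]
    exact eq_add_of_sub_eq h2
  · have h := H g
    rw [LinearPMap.mem_graph_iff] at h
    obtain ⟨f, h1, h2⟩ := h
    refine ⟨f, h1, ?_⟩
    rw [h2, h1, add_sub_cancel_right]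

/-- The graph of a bounded everywhere defined operator is closed, so it contains the closure of any
restriction; continuity and a dense domain give the reverse inclusion. -/
lemma closure_eq_everywhere {T : E →ₗ.[ℂ] F} {S : E →L[ℂ] F}
    (h : ∀ f g, (f, g) ∈ T.graph → S f = g) (hd : Dense (T.domain : Set E)) :
    T.closure = everywhere S := by
  have hle : T ≤ everywhere S := LinearPMap.le_of_le_graph (by
    rintro ⟨f, g⟩ hfg
    exact (mem_graph_everywhere S f g).2 (h f g hfg))
  have hclosed : (everywhere S).IsClosed := by
    have : ((everywhere S).graph : Set (E × F)) = {p | S p.1 = p.2} := by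
      ext ⟨f, g⟩
      exact mem_graph_everywhere S f g
    change IsClosed ((everywhere S).graph : Set (E × F))
    rw [this]
    exact isClosed_eq (by fun_prop) (by fun_prop)
  have hcl : T.IsClosable := hclosed.isClosable.leIsClosable hle
  apply LinearPMap.eq_of_eq_graph
  rw [← hcl.graph_closure_eq_closure_graph]
  apply le_antisymm
  · exact Submodule.topologicalClosure_minimal _ (LinearPMap.le_graph_of_le hle) hclosed
  · rintro ⟨f, g⟩ hfg
    rw [mem_graph_everywhere] at hfg
    subst hfg
    have hf : f ∈ closure (T.domain : Set E) := hd f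
    have hmap : MapsTo (fun f : E => (f, S f)) (T.domain : Set E) (T.graph : Set (E × F)) := by
      intro f hf
      obtain ⟨g, hg⟩ := (mem_domain_iff_mem_graph T f).1 hf
      change (f, S f) ∈ T.graph
      rwa [h f g hg]
    exact map_mem_closure (f := fun f : E => (f, S f)) (by fun_prop) hf hmap

lemma eq_of_closure_eq_everywhere {T : E →ₗ.[ℂ] F} {S : E →L[ℂ] F}
    (h : T.closure = everywhere S) {f : E} {g : F} (hfg : (f, g) ∈ T.graph) : S f = g :=
  (mem_graph_everywhere S f g).1 (h ▸ LinearPMap.le_graph_of_le T.le_closure hfg)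

lemma dense_domain_of_closure_eq_everywhere {T : E →ₗ.[ℂ] F} {S : E →L[ℂ] F}
    (h : T.closure = everywhere S) : Dense (T.domain : Set E) := by
  intro f
  have hf : (f, S f) ∈ T.closure.graph := h ▸ (mem_graph_everywhere S f _).2 rfl
  by_cases hT : T.IsClosable
  · rw [← hT.graph_closure_eq_closure_graph] at hf
    refine map_mem_closure (f := Prod.fst) continuous_fst hf ?_
    rintro ⟨f, g⟩ hfg
    exact (mem_domain_iff_mem_graph T f).2 ⟨g, hfg⟩
  -- For a non-closable `T` the default value of `T.closure` is `T` itself, which is then already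
  -- everywhere defined.
  · rw [LinearPMap.closure_def' hT] at hf
    exact subset_closure ((mem_domain_iff_mem_graph T f).2 ⟨_, hf⟩)

/-- The elementwise content of `IsPerturbedResolvent`. -/
structure PerturbedResolventData (H₀ : E →ₗ.[ℂ] E) (A : E →ₗ.[ℂ] F) (B : F →ₗ.[ℂ] E)
    (z : ℂ) (R : E →L[ℂ] E) (R₀ : E →L[ℂ] E) (AR : E →L[ℂ] F) (RB : F →L[ℂ] E)
    (Q : F →L[ℂ] F) : Prop where
  resolvent : IsResolventAt H₀ z R₀
  graph_A : ∀ f, (R₀ f, AR f) ∈ A.graph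
  dense_B : Dense (B.domain : Set F)
  apply_RB : ∀ f g, (f, g) ∈ B.graph → RB f = R₀ g
  apply_Q : ∀ f g, (f, g) ∈ B.graph → Q f = AR g
  injective : ∀ g, g + Q g = 0 → g = 0
  apply_R : ∀ f, ∃ g, g + Q g = AR f ∧ R f = R₀ f - RB g

lemma IsPerturbedResolvent.exists_data {H₀ : E →ₗ.[ℂ] E} {A : E →ₗ.[ℂ] F} {B : F →ₗ.[ℂ] E}
    {z : ℂ} {R : E →L[ℂ] E} (h : IsPerturbedResolvent H₀ A B z R) :
    ∃ R₀ AR RB Q, PerturbedResolventData H₀ A B z R R₀ AR RB Q := by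
  obtain ⟨R₀, AR, RB, Q, h1, h2, h3, h4, h5, rfl⟩ := h
  have hA : ∀ f, (R₀ f, AR f) ∈ A.graph := by
    intro f
    have h : (f, AR f) ∈ (prodOp A (everywhere R₀)).graph :=
      h2 ▸ (mem_graph_everywhere AR f _).2 rfl
    rw [mem_graph_prodOp] at h
    obtain ⟨g, hg, hA⟩ := h
    rw [mem_graph_everywhere] at hg
    rwa [hg]
  have hRB : ∀ f g, (f, g) ∈ B.graph → (f, R₀ g) ∈ (prodOp (everywhere R₀) B).graph :=
    fun f g hfg => (mem_graph_prodOp _ _ _ _).2 ⟨g, hfg, (mem_graph_everywhere _ _ _).2 rfl⟩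
  have hunit : IsUnit (1 + Q) := by
    have h := h5
    rw [spectrum.mem_resolventSet_iff] at h
    have e : algebraMap ℂ (F →L[ℂ] F) (-1) - Q = -(1 + Q) := by
      rw [map_neg, map_one]; abel
    rw [e] at h
    exact (IsUnit.neg_iff _).1 h
  refine ⟨R₀, AR, RB, Q, h1, hA, ?_, ?_, ?_, ?_, ?_⟩
  · refine (dense_domain_of_closure_eq_everywhere h3).mono ?_
    intro f hf
    obtain ⟨k, hk⟩ := (mem_domain_iff_mem_graph _ _).1 hf
    rw [mem_graph_prodOp] at hk
    obtain ⟨g, hg, -⟩ := hk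
    exact (mem_domain_iff_mem_graph _ _).2 ⟨g, hg⟩
  · exact fun f g hfg => eq_of_closure_eq_everywhere h3 (hRB f g hfg)
  · exact fun f g hfg => eq_of_closure_eq_everywhere h4
      ((mem_graph_prodOp _ _ _ _).2 ⟨_, hRB f g hfg, hA g⟩)
  · intro g hg
    have h : (Ring.inverse (1 + Q) * (1 + Q)) g = g := by
      rw [Ring.inverse_mul_cancel _ hunit]; rfl
    rw [← h]
    change Ring.inverse (1 + Q) (g + Q g) = 0
    rw [hg, map_zero]
  · intro f
    refine ⟨Ring.inverse (1 + Q) (AR f), ?_, rfl⟩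
    change ((1 + Q) * Ring.inverse (1 + Q)) (AR f) = AR f
    rw [Ring.mul_inverse_cancel _ hunit]; rfl

lemma IsResolventAt.resolvent_identity {T : E →ₗ.[ℂ] E} {z w : ℂ} {S S' : E →L[ℂ] E}
    (h : IsResolventAt T z S) (h' : IsResolventAt T w S') (f : E) :
    S f - S' f = (z - w) • S (S' f) := by
  rw [isResolventAt_iff_graph] at h h'
  have e := h.1 _ _ (h'.2 f)
  have e2 : f + w • S' f - z • S' f = f - (z - w) • S' f := by rw [sub_smul]; abel
  rw [e2, map_sub, map_smul] at e
  rw [sub_eq_iff_eq_add'] at e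
  rw [e]; abel

/-! ### Resolvent identities for the perturbed resolvent. -/

variable {H₀ : E →ₗ.[ℂ] E} {A : E →ₗ.[ℂ] F} {B : F →ₗ.[ℂ] E} {z w : ℂ}
  {R R' R₀ R₀' : E →L[ℂ] E} {AR AR' : E →L[ℂ] F} {RB RB' : F →L[ℂ] E} {Q Q' : F →L[ℂ] F}

namespace PerturbedResolventData

/-- This is `A` applied to the first resolvent identity of `R₀`. No continuity of `A` is involved:
its graph is linear and single-valued. -/
lemma sub_AR (h : PerturbedResolventData H₀ A B z R R₀ AR RB Q)
    (h' : PerturbedResolventData H₀ A B w R' R₀' AR' RB' Q') (f : E) :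
    AR f - AR' f = (z - w) • AR (R₀' f) := by
  have h1 := A.graph.sub_mem (h.graph_A f) (h'.graph_A f)
  have h2 := A.graph.smul_mem (z - w) (h.graph_A (R₀' f))
  refine A.mem_graph_snd_inj h1 h2 ?_
  exact h.resolvent.resolvent_identity h'.resolvent f

/-- On `dom B` this is the resolvent identity of `R₀`; both sides are continuous and `dom B` is
dense. The same argument gives `sub_Q`. -/
lemma sub_RB (h : PerturbedResolventData H₀ A B z R R₀ AR RB Q)
    (h' : PerturbedResolventData H₀ A B w R' R₀' AR' RB' Q') (f : F) :
    RB f - RB' f = (z - w) • R₀ (RB' f) := by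
  have e : (fun f => RB f - RB' f) = fun f => (z - w) • R₀ (RB' f) := by
    refine Continuous.ext_on h.dense_B (by fun_prop) (by fun_prop) ?_
    intro f hf
    obtain ⟨g, hg⟩ := (mem_domain_iff_mem_graph _ _).1 hf
    dsimp only
    rw [h.apply_RB _ _ hg, h'.apply_RB _ _ hg]
    exact h.resolvent.resolvent_identity h'.resolvent g
  exact congrFun e f

lemma sub_Q (h : PerturbedResolventData H₀ A B z R R₀ AR RB Q)
    (h' : PerturbedResolventData H₀ A B w R' R₀' AR' RB' Q') (f : F) :
    Q f - Q' f = (z - w) • AR (RB' f) := by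
  have e : (fun f => Q f - Q' f) = fun f => (z - w) • AR (RB' f) := by
    refine Continuous.ext_on h.dense_B (by fun_prop) (by fun_prop) ?_
    intro f hf
    obtain ⟨g, hg⟩ := (mem_domain_iff_mem_graph _ _).1 hf
    dsimp only
    rw [h.apply_Q _ _ hg, h'.apply_Q _ _ hg, h'.apply_RB _ _ hg]
    exact h.sub_AR h' g
  exact congrFun e f

/-- The first resolvent identity for the perturbed resolvent. -/
lemma resolvent_identity (h : PerturbedResolventData H₀ A B z R R₀ AR RB Q)
    (h' : PerturbedResolventData H₀ A B w R' R₀' AR' RB' Q') (f : E) :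
    R f - R' f = (z - w) • R (R' f) := by
  obtain ⟨g', hg', hR'⟩ := h'.apply_R f
  obtain ⟨g, hg, hR⟩ := h.apply_R f
  obtain ⟨k, hk, hRR⟩ := h.apply_R (R' f)
  have e1 := h.sub_AR h' f
  have e2 := h.sub_Q h' g'
  have e3 := h.sub_RB h' g'
  have e4 := h.resolvent.resolvent_identity h'.resolvent f
  -- Here `(1 + Q)(g - g') = (AR - AR') f - (Q - Q') g' = (z - w) AR (R₀' f - RB' g') = (z - w) AR
  -- (R' f) = (1 + Q)((z - w) k)`, and `1 + Q` is injective.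
  have key : (z - w) • k = g - g' := by
    rw [← sub_eq_zero]
    apply h.injective
    have : (z - w) • k + (z - w) • Q k = (z - w) • AR (R₀' f) - (z - w) • AR (RB' g') := by
      rw [← smul_add, hk, hR', map_sub, smul_sub]
    rw [← e1, ← e2, ← hg, ← hg'] at this
    rw [map_sub, map_sub, map_smul]
    calc (z - w) • k - (g - g') + ((z - w) • Q k - (Q g - Q g'))
        = ((z - w) • k + (z - w) • Q k) - (g - g') - (Q g - Q g') := by abel
      _ = 0 := by rw [this]; abel
  rw [hRR, smul_sub, hR', map_sub, smul_sub, ← e3, ← e4, ← map_smul, key, map_sub, hR]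
  abel

/-- If `R f = 0`, then `R₀ f = RB g` with `(1 + Q) g = AR f`. Closedness of `A` extends `A RB = Q`
from `dom B` to the whole space, so `AR f = Q g`, whence `g = 0`, `R₀ f = 0` and `f = 0`.
Injectivity is what makes `H = w + R(w)⁻¹` meaningful. -/
lemma injective_of_isClosed (hA : A.IsClosed)
    (h : PerturbedResolventData H₀ A B z R R₀ AR RB Q) {f : E} (hf : R f = 0) : f = 0 := by
  have hgraph : ∀ g, (RB g, Q g) ∈ A.graph := by
    intro g
    have : (RB g, Q g) ∈ closure (A.graph : Set (E × F)) := by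
      refine map_mem_closure (f := fun g => (RB g, Q g)) (by fun_prop) (h.dense_B g) ?_
      intro g hg
      obtain ⟨k, hk⟩ := (mem_domain_iff_mem_graph _ _).1 hg
      change (RB g, Q g) ∈ A.graph
      rw [h.apply_RB _ _ hk, h.apply_Q _ _ hk]
      exact h.graph_A k
    rwa [IsClosed.closure_eq hA] at this
  obtain ⟨g, hg, hR⟩ := h.apply_R f
  rw [hf] at hR
  have e : R₀ f = RB g := (sub_eq_zero.1 hR.symm)
  have e2 : AR f = Q g := A.mem_graph_snd_inj (h.graph_A f) (hgraph g) e
  have hg0 : g = 0 := by rwa [e2, add_eq_right] at hg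
  rw [hg0, map_zero] at e
  have h2 := ((isResolventAt_iff_graph _ _ _).1 h.resolvent).2 f
  rw [e] at h2
  have h3 : f + z • (0 : E) = 0 := H₀.mem_graph_snd_inj h2 H₀.graph.zero_mem rfl
  simpa using h3

end PerturbedResolventData

/-- Every point at which the perturbed resolvent is defined belongs to the resolvent set of the
closed extension, and the extension does not depend on the point that defines it. -/
theorem mem_rho_perturbedOp (hA : A.IsClosed) (h : IsPerturbedResolvent H₀ A B z R) :
    z ∈ rho (perturbedOp H₀ A B) := by
  have hex : ∃ p : ℂ × (E →L[ℂ] E), IsPerturbedResolvent H₀ A B p.1 p.2 := ⟨(z, R), h⟩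
  rw [perturbedOp, dif_pos hex]
  -- The point `w` selected by choice in the definition need not be `z`.
  generalize hp : hex.choose = p
  have hp' : IsPerturbedResolvent H₀ A B p.1 p.2 := hp ▸ hex.choose_spec
  obtain ⟨w, S⟩ := p
  obtain ⟨_, _, _, _, D⟩ := h.exists_data
  obtain ⟨_, _, _, _, D'⟩ := hp'.exists_data
  dsimp only at D' ⊢
  have hker : LinearMap.ker (everywhere S).toFun = ⊥ := by
    rw [LinearMap.ker_eq_bot']
    rintro ⟨f, hf⟩ h0
    exact Subtype.ext (D'.injective_of_isClosed hA h0)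
  have hg : ∀ f k, (f, k) ∈ ((w • (LinearMap.id : E →ₗ[ℂ] E)) +ᵥ (everywhere S).inverse).graph ↔
      S (k - w • f) = f := by
    intro f k
    have h1 : (f, k - w • f) ∈ (everywhere S).inverse.graph ↔ S (k - w • f) = f := by
      rw [LinearPMap.inverse_graph hker, ← mem_graph_everywhere, Submodule.mem_map]
      constructor
      · rintro ⟨⟨a, b⟩, hab, he⟩
        have h2 : b = f := congrArg Prod.fst he
        have h3 : a = k - w • f := congrArg Prod.snd he
        rwa [← h3, ← h2]
      · exact fun h => ⟨_, h, rfl⟩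
    rw [← h1, LinearPMap.mem_graph_iff, LinearPMap.mem_graph_iff]
    constructor
    · rintro ⟨y, hy, h2⟩
      refine ⟨y, hy, ?_⟩
      dsimp only at hy h2
      rw [← h2, ← hy]
      exact (add_sub_cancel_left _ _).symm
    · rintro ⟨y, hy, h2⟩
      refine ⟨y, hy, ?_⟩
      dsimp only at hy h2
      change w • (y : E) + (everywhere S).inverse y = k
      rw [h2, hy, add_sub_cancel]
  refine ⟨R, (isResolventAt_iff_graph _ _ _).2 ⟨?_, ?_⟩⟩
  · intro f k hfk
    -- Membership in the graph of `H` means `S (k - w • f) = f`. The resolvent identity for `R` and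
    -- `S` turns this into the same relation for `R` and `z`; with the roles of `R` and `S`
    -- exchanged it gives the other half.
    rw [hg] at hfk
    have e := D.resolvent_identity D' (k - w • f)
    rw [hfk] at e
    have e2 : k - z • f = (k - w • f) - (z - w) • f := by rw [sub_smul]; abel
    rw [e2, map_sub, map_smul, ← e]
    abel
  · intro g
    rw [hg]
    have e := D'.resolvent_identity D g
    have e2 : g + z • R g - w • R g = g - (w - z) • R g := by rw [sub_smul]; abel
    rw [e2, map_sub, map_smul, ← e]
    abel

end OperatorLemmas

/-! ### Integral operators with exponentially decaying convolution kernels -/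

lemma lintegral_mul_sq_le {α : Type*} [MeasurableSpace α] {μ : Measure α} {f g : α → ℝ≥0∞}
    (hf : AEMeasurable f μ) (hg : AEMeasurable g μ) :
    (∫⁻ x, f x * g x ∂μ) ^ 2 ≤ (∫⁻ x, f x ^ 2 ∂μ) * ∫⁻ x, g x ^ 2 ∂μ := by
  have h := ENNReal.lintegral_mul_le_Lp_mul_Lq μ Real.HolderConjugate.two_two hf hg
  have e : ∀ a : ℝ≥0∞, (a ^ (1 / 2 : ℝ)) ^ 2 = a := fun a => by
    rw [← ENNReal.rpow_natCast, ← ENNReal.rpow_mul]; norm_num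
  calc (∫⁻ x, f x * g x ∂μ) ^ 2 ≤ _ := pow_le_pow_left' h 2
    _ = _ := by
      rw [mul_pow, e, e]
      simp only [ENNReal.rpow_two]

lemma eLpNorm_two_sq {f : ℝ → Spinor} :
    eLpNorm f 2 volume ^ 2 = ∫⁻ x, ‖f x‖ₑ ^ 2 := by
  have h := eLpNorm_nnreal_pow_eq_lintegral (f := f) (μ := (volume : Measure ℝ)) (p := 2) (by simp)
  simpa using h

lemma lintegral_enorm_sq_lt_top (g : StateSpace) : ∫⁻ x, ‖(g : ℝ → Spinor) x‖ₑ ^ 2 < ⊤ := by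
  rw [← eLpNorm_two_sq]
  exact ENNReal.pow_lt_top (Lp.eLpNorm_lt_top g)

/-- The weight `e^{-s|t|}`. -/
def expWeight (s t : ℝ) : ℝ≥0∞ := ENNReal.ofReal (Real.exp (-s * |t|))

lemma expWeight_neg (s t : ℝ) : expWeight s (-t) = expWeight s t := by
  rw [expWeight, abs_neg, expWeight]

lemma measurable_expWeight (s : ℝ) : Measurable (expWeight s) := by
  unfold expWeight
  fun_prop

lemma expWeight_le_one {s : ℝ} (hs : 0 ≤ s) (t : ℝ) : expWeight s t ≤ 1 := by
  rw [expWeight]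
  refine ENNReal.ofReal_le_one.2 (Real.exp_le_one_iff.2 ?_)
  have := mul_nonneg hs (abs_nonneg t)
  linarith

lemma expWeight_half_sq (s t : ℝ) : expWeight (s / 2) t ^ 2 = expWeight s t := by
  rw [expWeight, ← ENNReal.ofReal_pow (Real.exp_pos _).le, ← Real.exp_nat_mul, expWeight]
  congr 2
  push_cast
  ring

/-- A convolution kernel bounded by `c e^{-s|t|}`. -/
structure IsExpKernel (N : ℝ → Spinor →L[ℂ] Spinor) (c : ℝ≥0) (s : ℝ) : Prop where
  pos : 0 < s
  meas : StronglyMeasurable N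
  bound : ∀ t, ‖N t‖ₑ ≤ c * expWeight s t

/-- A matrix function `b` with `∫ ‖b(y)‖² e^{-s|x-y|} dy ≤ C` uniformly in `x`. -/
structure IsExpBounded (b : ℝ → Spinor →L[ℂ] Spinor) (s : ℝ) (C : ℝ≥0) : Prop where
  meas : AEStronglyMeasurable b volume
  bound : ∀ x, ∫⁻ y, ‖b y‖ₑ ^ 2 * expWeight s (y - x) ≤ C

/-- `∫ N(x - y) b(y) g(y) dy`. -/
def kerInt (N b : ℝ → Spinor →L[ℂ] Spinor) (g : ℝ → Spinor) (x : ℝ) : Spinor :=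
  ∫ y, N (x - y) (b y (g y))

lemma aestronglyMeasurable_apply {α : Type*} [MeasurableSpace α] {μ : Measure α}
    {b : α → Spinor →L[ℂ] Spinor} {g : α → Spinor} (hb : AEStronglyMeasurable b μ)
    (hg : AEStronglyMeasurable g μ) : AEStronglyMeasurable (fun x => b x (g x)) μ :=
  (isBoundedBilinearMap_apply (𝕜 := ℂ) (E := Spinor) (F := Spinor)).continuous.comp_aestronglyMeasurable
    (hb.prodMk hg)

lemma enorm_apply_le (S : Spinor →L[ℂ] Spinor) (v : Spinor) : ‖S v‖ₑ ≤ ‖S‖ₑ * ‖v‖ₑ := by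
  have h := S.le_opNNNorm v
  rw [enorm_eq_nnnorm, enorm_eq_nnnorm, enorm_eq_nnnorm]
  exact_mod_cast h

section Kernel

variable {N a b : ℝ → Spinor →L[ℂ] Spinor} {c Ca Cb : ℝ≥0} {s : ℝ}

lemma IsExpKernel.aestronglyMeasurable_prod (hN : IsExpKernel N c s) (hb : IsExpBounded b s Cb)
    {g : ℝ → Spinor} (hg : AEStronglyMeasurable g volume) :
    AEStronglyMeasurable (fun p : ℝ × ℝ => N (p.1 - p.2) (b p.2 (g p.2)))
      ((volume : Measure ℝ).prod volume) :=
  aestronglyMeasurable_apply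
    (hN.meas.comp_measurable (measurable_fst.sub measurable_snd)).aestronglyMeasurable
    (aestronglyMeasurable_apply hb.meas.comp_snd hg.comp_snd)

lemma IsExpKernel.aestronglyMeasurable_section (hN : IsExpKernel N c s) (hb : IsExpBounded b s Cb)
    {g : ℝ → Spinor} (hg : AEStronglyMeasurable g volume) (x : ℝ) :
    AEStronglyMeasurable (fun y => N (x - y) (b y (g y))) volume :=
  aestronglyMeasurable_apply
    (hN.meas.comp_measurable (measurable_const.sub measurable_id)).aestronglyMeasurable
    (aestronglyMeasurable_apply hb.meas hg)

/-- The weight `e^{-s|t|}` is split into two factors `e^{-s|t|/2}`, one attached to `b` and one to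
`g`, before Cauchy–Schwarz is applied; the factor with `b` is then at most `Cb`. -/
lemma IsExpKernel.sq_lintegral_le (hN : IsExpKernel N c s) (hb : IsExpBounded b s Cb)
    {g : ℝ → Spinor} (hg : AEStronglyMeasurable g volume) (x : ℝ) :
    (∫⁻ y, ‖N (x - y) (b y (g y))‖ₑ) ^ 2 ≤
      c ^ 2 * Cb * ∫⁻ y, ‖g y‖ₑ ^ 2 * expWeight s (x - y) := by
  have hw : Measurable fun y => expWeight (s / 2) (x - y) :=
    (measurable_expWeight _).comp (measurable_const.sub measurable_id)
  have h1 : ∫⁻ y, ‖N (x - y) (b y (g y))‖ₑ ≤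
      ∫⁻ y, c * ((‖b y‖ₑ * expWeight (s / 2) (x - y)) * (‖g y‖ₑ * expWeight (s / 2) (x - y))) := by
    refine lintegral_mono fun y => ?_
    calc ‖N (x - y) (b y (g y))‖ₑ ≤ ‖N (x - y)‖ₑ * (‖b y‖ₑ * ‖g y‖ₑ) :=
          (enorm_apply_le _ _).trans (mul_le_mul_right (enorm_apply_le _ _) _)
      _ ≤ (c * expWeight s (x - y)) * (‖b y‖ₑ * ‖g y‖ₑ) :=
          mul_le_mul_left (hN.bound _) _
      _ = _ := by rw [← expWeight_half_sq]; ring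
  rw [lintegral_const_mul' _ _ ENNReal.coe_ne_top] at h1
  calc (∫⁻ y, ‖N (x - y) (b y (g y))‖ₑ) ^ 2 ≤ _ := pow_le_pow_left' h1 2
    _ ≤ c ^ 2 * ((∫⁻ y, (‖b y‖ₑ * expWeight (s / 2) (x - y)) ^ 2) *
          ∫⁻ y, (‖g y‖ₑ * expWeight (s / 2) (x - y)) ^ 2) := by
        rw [mul_pow]
        exact mul_le_mul_right (lintegral_mul_sq_le (hb.meas.enorm.mul hw.aemeasurable)
          (hg.enorm.mul hw.aemeasurable)) _
    _ ≤ c ^ 2 * (Cb * ∫⁻ y, ‖g y‖ₑ ^ 2 * expWeight s (x - y)) := by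
        simp only [mul_pow, expWeight_half_sq]
        refine mul_le_mul_right (mul_le_mul_left ?_ _) _
        refine le_trans (le_of_eq (lintegral_congr fun y => ?_)) (hb.bound x)
        rw [← expWeight_neg, neg_sub]
    _ = _ := by ring

/-- Integrability holds at every `x`, not only almost every `x`, so `kerInt` is additive in `g`
pointwise. -/
lemma IsExpKernel.integrable_section (hN : IsExpKernel N c s) (hb : IsExpBounded b s Cb)
    (g : StateSpace) (x : ℝ) : Integrable (fun y => N (x - y) (b y ((g : ℝ → Spinor) y))) := by
  refine ⟨hN.aestronglyMeasurable_section hb (Lp.aestronglyMeasurable g) x, ?_⟩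
  have h := hN.sq_lintegral_le hb (Lp.aestronglyMeasurable g) x
  have h2 : ∫⁻ y, ‖(g : ℝ → Spinor) y‖ₑ ^ 2 * expWeight s (x - y) < ⊤ :=
    lt_of_le_of_lt (lintegral_mono fun y => mul_le_of_le_one_right' (expWeight_le_one hN.pos.le _))
      (lintegral_enorm_sq_lt_top g)
  have h3 : (∫⁻ y, ‖N (x - y) (b y ((g : ℝ → Spinor) y))‖ₑ) ^ 2 < ⊤ :=
    h.trans_lt (ENNReal.mul_lt_top (by finiteness) h2)
  exact (ENNReal.pow_lt_top_iff (n := 2)).1 h3 |>.resolve_right (by norm_num)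

lemma IsExpKernel.aestronglyMeasurable_kerInt (hN : IsExpKernel N c s) (hb : IsExpBounded b s Cb)
    {g : ℝ → Spinor} (hg : AEStronglyMeasurable g volume) :
    AEStronglyMeasurable (kerInt N b g) volume :=
  (hN.aestronglyMeasurable_prod hb hg).integral_prod_right'

/-- A Schur test: after the pointwise Cauchy–Schwarz bound, Tonelli allows the `x`-integral to be
done first, and the weighted integral of `‖a‖²` is at most `Ca` uniformly in `y`. -/
lemma IsExpKernel.lintegral_kerInt_le (hN : IsExpKernel N c s) (ha : IsExpBounded a s Ca)
    (hb : IsExpBounded b s Cb) {g : ℝ → Spinor} (hg : AEStronglyMeasurable g volume) :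
    ∫⁻ x, ‖a x (kerInt N b g x)‖ₑ ^ 2 ≤ c ^ 2 * Ca * Cb * ∫⁻ y, ‖g y‖ₑ ^ 2 := by
  have hm : AEMeasurable (fun p : ℝ × ℝ => ‖a p.1‖ₑ ^ 2 * (‖g p.2‖ₑ ^ 2 * expWeight s (p.1 - p.2)))
      ((volume : Measure ℝ).prod volume) :=
    (ha.meas.comp_fst.enorm.pow_const 2).mul ((hg.comp_snd.enorm.pow_const 2).mul
      ((measurable_expWeight s).comp (measurable_fst.sub measurable_snd)).aemeasurable)
  have hm' : ∀ x, AEMeasurable (fun y => ‖g y‖ₑ ^ 2 * expWeight s (x - y)) volume := fun x =>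
    (hg.enorm.pow_const 2).mul
      ((measurable_expWeight s).comp (measurable_const.sub measurable_id)).aemeasurable
  have hm'' : ∀ y, AEMeasurable (fun x => ‖a x‖ₑ ^ 2 * expWeight s (x - y)) volume := fun x =>
    (ha.meas.enorm.pow_const 2).mul
      ((measurable_expWeight s).comp (measurable_id.sub measurable_const)).aemeasurable
  calc ∫⁻ x, ‖a x (kerInt N b g x)‖ₑ ^ 2
      ≤ ∫⁻ x, (c ^ 2 * Cb) * (‖a x‖ₑ ^ 2 * ∫⁻ y, ‖g y‖ₑ ^ 2 * expWeight s (x - y)) := by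
        refine lintegral_mono fun x => ?_
        calc ‖a x (kerInt N b g x)‖ₑ ^ 2 ≤ (‖a x‖ₑ * ‖kerInt N b g x‖ₑ) ^ 2 :=
              pow_le_pow_left' (enorm_apply_le _ _) 2
          _ = ‖a x‖ₑ ^ 2 * ‖kerInt N b g x‖ₑ ^ 2 := mul_pow _ _ _
          _ ≤ ‖a x‖ₑ ^ 2 * (c ^ 2 * Cb * ∫⁻ y, ‖g y‖ₑ ^ 2 * expWeight s (x - y)) := by
              refine mul_le_mul_right ?_ _
              exact (pow_le_pow_left' (enorm_integral_le_lintegral_enorm _) 2).trans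
                (hN.sq_lintegral_le hb hg x)
          _ = _ := by ring
    _ = (c ^ 2 * Cb) * ∫⁻ x, ∫⁻ y, ‖a x‖ₑ ^ 2 * (‖g y‖ₑ ^ 2 * expWeight s (x - y)) := by
        rw [lintegral_const_mul' _ _ (by finiteness)]
        congr 1
        refine lintegral_congr fun x => ?_
        rw [lintegral_const_mul'' _ (hm' x)]
    _ = (c ^ 2 * Cb) * ∫⁻ y, ∫⁻ x, ‖a x‖ₑ ^ 2 * (‖g y‖ₑ ^ 2 * expWeight s (x - y)) := by
        rw [lintegral_lintegral_swap hm]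
    _ ≤ (c ^ 2 * Cb) * ∫⁻ y, ‖g y‖ₑ ^ 2 * Ca := by
        refine mul_le_mul_right (lintegral_mono fun y => ?_) _
        calc ∫⁻ x, ‖a x‖ₑ ^ 2 * (‖g y‖ₑ ^ 2 * expWeight s (x - y))
            = ∫⁻ x, ‖g y‖ₑ ^ 2 * (‖a x‖ₑ ^ 2 * expWeight s (x - y)) :=
              lintegral_congr fun x => by ring
          _ = ‖g y‖ₑ ^ 2 * ∫⁻ x, ‖a x‖ₑ ^ 2 * expWeight s (x - y) :=
              lintegral_const_mul'' _ (hm'' y)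
          _ ≤ _ := mul_le_mul_right (ha.bound y) _
    _ = _ := by
        rw [lintegral_mul_const' _ _ ENNReal.coe_ne_top]
        ring

lemma IsExpKernel.eLpNorm_kerInt_le (hN : IsExpKernel N c s) (ha : IsExpBounded a s Ca)
    (hb : IsExpBounded b s Cb) {g : ℝ → Spinor} (hg : AEStronglyMeasurable g volume) :
    eLpNorm (fun x => a x (kerInt N b g x)) 2 volume ≤
      (c * NNReal.sqrt (Ca * Cb) : ℝ≥0) * eLpNorm g 2 volume := by
  have h := hN.lintegral_kerInt_le ha hb hg
  rw [← eLpNorm_two_sq, ← eLpNorm_two_sq] at h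
  have h2 : (c ^ 2 * Ca * Cb : ℝ≥0∞) = ((c * NNReal.sqrt (Ca * Cb) : ℝ≥0) : ℝ≥0∞) ^ 2 := by
    have h3 : (c * NNReal.sqrt (Ca * Cb)) ^ 2 = c ^ 2 * Ca * Cb := by
      rw [mul_pow, NNReal.sq_sqrt, mul_assoc]
    have h4 := congrArg ((↑) : ℝ≥0 → ℝ≥0∞) h3
    rw [ENNReal.coe_pow] at h4
    rw [h4]
    push_cast
    rfl
  rw [h2, ← mul_pow] at h
  exact (ENNReal.pow_le_pow_left_iff (two_ne_zero)).1 h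

/-- The integral operator with kernel `a(x) N(x - y) b(y)` is bounded on `L²`. -/
theorem IsExpKernel.exists_operator (hN : IsExpKernel N c s) (ha : IsExpBounded a s Ca)
    (hb : IsExpBounded b s Cb) :
    ∃ K : StateSpace →L[ℂ] StateSpace,
      (∀ g : StateSpace, (K g : ℝ → Spinor) =ᵐ[volume] fun x => a x (kerInt N b g x)) ∧
      ‖K‖ ≤ c * Real.sqrt (Ca * Cb) := by
  have hmem : ∀ g : StateSpace, MemLp (fun x => a x (kerInt N b g x)) 2 volume := fun g =>
    ⟨aestronglyMeasurable_apply ha.meas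
      (hN.aestronglyMeasurable_kerInt hb (Lp.aestronglyMeasurable g)),
      (hN.eLpNorm_kerInt_le ha hb (Lp.aestronglyMeasurable g)).trans_lt
        (ENNReal.mul_lt_top ENNReal.coe_lt_top (Lp.eLpNorm_lt_top g))⟩
  have hadd : ∀ g h : StateSpace, ∀ x, kerInt N b (g + h : StateSpace) x =
      kerInt N b g x + kerInt N b h x := by
    intro g h x
    rw [kerInt, kerInt, kerInt, ← integral_add (hN.integrable_section hb g x)
      (hN.integrable_section hb h x)]
    refine integral_congr_ae ?_
    filter_upwards [Lp.coeFn_add g h] with y hy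
    rw [hy, Pi.add_apply, map_add, map_add]
  have hsmul : ∀ (r : ℂ) (g : StateSpace), ∀ x, kerInt N b (r • g : StateSpace) x =
      r • kerInt N b g x := by
    intro r g x
    rw [kerInt, kerInt, ← integral_smul]
    refine integral_congr_ae ?_
    filter_upwards [Lp.coeFn_smul r g] with y hy
    rw [hy, Pi.smul_apply, map_smul, map_smul]
  let K₀ : StateSpace →ₗ[ℂ] StateSpace :=
    { toFun := fun g => (hmem g).toLp
      map_add' := fun g h => by
        rw [← MemLp.toLp_add]
        refine MemLp.toLp_congr _ _ (Eventually.of_forall fun x => ?_)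
        simp only [Pi.add_apply, hadd, map_add]
      map_smul' := fun r g => by
        rw [RingHom.id_apply, ← MemLp.toLp_const_smul]
        refine MemLp.toLp_congr _ _ (Eventually.of_forall fun x => ?_)
        simp only [Pi.smul_apply, hsmul, map_smul] }
  refine ⟨K₀.mkContinuous (c * Real.sqrt (Ca * Cb)) ?_, ?_, ?_⟩
  · intro g
    change ‖(hmem g).toLp‖ ≤ _
    rw [Lp.norm_toLp, Lp.norm_def]
    have h := hN.eLpNorm_kerInt_le ha hb (Lp.aestronglyMeasurable g)
    have h2 := ENNReal.toReal_mono (ENNReal.mul_ne_top ENNReal.coe_ne_top (Lp.eLpNorm_ne_top g)) h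
    rw [ENNReal.toReal_mul, ENNReal.coe_toReal] at h2
    simpa using h2
  · exact fun g => (hmem g).coeFn_toLp
  · exact K₀.mkContinuous_norm_le (by positivity) _

end Kernel

/-! ### Constant matrices -/

lemma matOp_apply (M : Matrix (Fin 2) (Fin 2) ℂ) (v : Spinor) (i : Fin 2) :
    matOp M v i = M i 0 * v 0 + M i 1 * v 1 := by
  rw [matOp]
  simp [Matrix.mulVec, dotProduct]

lemma matOp_mul_apply (M M' : Matrix (Fin 2) (Fin 2) ℂ) (v : Spinor) :
    matOp (M * M') v = matOp M (matOp M' v) := by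
  rw [matOp, map_mul]; rfl

lemma matOp_add_apply (M M' : Matrix (Fin 2) (Fin 2) ℂ) (v : Spinor) :
    matOp (M + M') v = matOp M v + matOp M' v := by
  rw [matOp, map_add]; rfl

lemma matOp_smul_apply (r : ℂ) (M : Matrix (Fin 2) (Fin 2) ℂ) (v : Spinor) :
    matOp (r • M) v = r • matOp M v := by
  rw [matOp, map_smul]; rfl

lemma matOp_one_apply (v : Spinor) : matOp 1 v = v := by
  rw [matOp, map_one]; rfl

lemma constOp_ae (M : Matrix (Fin 2) (Fin 2) ℂ) (f : StateSpace) :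
    (constOp M f : ℝ → Spinor) =ᵐ[volume] fun x => matOp M ((f : ℝ → Spinor) x) :=
  ContinuousLinearMap.coeFn_compLpL _ _

lemma constOp_mul_apply (M M' : Matrix (Fin 2) (Fin 2) ℂ) (f : StateSpace) :
    constOp (M * M') f = constOp M (constOp M' f) := by
  refine Lp.ext ?_
  filter_upwards [constOp_ae (M * M') f, constOp_ae M (constOp M' f), constOp_ae M' f]
    with x h1 h2 h3
  rw [h1, h2, h3, matOp_mul_apply]

lemma constOp_add_apply (M M' : Matrix (Fin 2) (Fin 2) ℂ) (f : StateSpace) :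
    constOp (M + M') f = constOp M f + constOp M' f := by
  refine Lp.ext ?_
  filter_upwards [constOp_ae (M + M') f, constOp_ae M f, constOp_ae M' f,
    Lp.coeFn_add (constOp M f) (constOp M' f)] with x h1 h2 h3 h4
  rw [h1, h4, Pi.add_apply, h2, h3, matOp_add_apply]

lemma constOp_smul_one_apply (r : ℂ) (f : StateSpace) :
    constOp (r • (1 : Matrix (Fin 2) (Fin 2) ℂ)) f = r • f := by
  refine Lp.ext ?_
  filter_upwards [constOp_ae (r • 1) f, Lp.coeFn_smul r f] with x h1 h2
  rw [h1, h2, Pi.smul_apply, matOp_smul_apply, matOp_one_apply]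

/-- The matrix `i σ₁ (z - m σ₃)`: a solution of `(H₀ - z) f = g` satisfies
`f' = i σ₁ g + i σ₁ (z - m σ₃) f`. -/
def odeMatrix (m : ℝ) (z : ℂ) : Matrix (Fin 2) (Fin 2) ℂ :=
  !![0, Complex.I * (z + m); Complex.I * (z - m), 0]

lemma odeMatrix_sq (m : ℝ) (z : ℂ) :
    odeMatrix m z * odeMatrix m z = (-(z ^ 2 - (m : ℂ) ^ 2)) • 1 := by
  ext i j
  fin_cases i <;> fin_cases j <;> simp [odeMatrix, Matrix.mul_apply] <;>
    linear_combination (z + m) * (z - m) * Complex.I_sq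

/-! ### The Green kernel of the free Dirac operator -/

/-- The matrix `(i/2) (ζ, ε; ε, ζ⁻¹)` with `ζ = (z + m)/k`, where `k² = z² - m²`. -/
def greenMatrix (m : ℝ) (z k ε : ℂ) : Matrix (Fin 2) (Fin 2) ℂ :=
  !![Complex.I / 2 * ((z + m) / k), Complex.I / 2 * ε;
    Complex.I / 2 * ε, Complex.I / 2 * ((z - m) / k)]

/-- The convolution kernel of `(H₀ - z)⁻¹`. -/
def greenKernel (m : ℝ) (z k : ℂ) (t : ℝ) : Spinor →L[ℂ] Spinor :=
  if 0 < t then Complex.exp (Complex.I * k * t) • matOp (greenMatrix m z k 1)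
  else Complex.exp (-(Complex.I * k * t)) • matOp (greenMatrix m z k (-1))

section Green

variable {m : ℝ} {z k : ℂ}

/-- The columns of the Green matrix are eigenvectors of the ODE matrix, so `e^{ikεt}` times the
Green matrix solves the homogeneous Dirac equation. -/
lemma odeMatrix_mul_greenMatrix (hk : k ≠ 0) (hkz : k ^ 2 = z ^ 2 - (m : ℂ) ^ 2) {ε : ℂ}
    (hε : ε ^ 2 = 1) :
    odeMatrix m z * greenMatrix m z k ε = (Complex.I * k * ε) • greenMatrix m z k ε := by
  ext i j
  fin_cases i <;> fin_cases j <;> simp [odeMatrix, greenMatrix, Matrix.mul_apply] <;> field_simp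
  all_goals linear_combination -hkz - k ^ 2 * hε

lemma eta_pos {t : ℝ} (ht : 0 ≤ t) : 0 < eta t := by
  have := inv_nonneg.2 ht
  exact Real.sqrt_pos.2 (by positivity)

/-- The matrix has rank one: it is `(i/2) (ζ, ε)ᵀ (1, ε ζ⁻¹)`. Its norm is therefore controlled by
half the product of the two vector norms, `½ √((|ζ|² + 1)(1 + |ζ|⁻²))`, which equals `η(|ζ|²)`, and
`ζ² = Φ(z)`. -/
lemma norm_greenMatrix_le (hk : k ≠ 0) (hkz : k ^ 2 = z ^ 2 - (m : ℂ) ^ 2) {ε : ℂ}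
    (hε : ε ^ 2 = 1) : ‖matOp (greenMatrix m z k ε)‖ ≤ eta ‖Phi m z‖ := by
  have hzz : (z + m) * (z - m) = k ^ 2 := by rw [hkz]; ring
  have hp : z + m ≠ 0 := fun h => hk (by simpa [h] using hzz.symm)
  have hq : z - m ≠ 0 := fun h => hk (by simpa [h] using hzz.symm)
  set ζ := (z + m) / k with hζ
  have hζ0 : ζ ≠ 0 := div_ne_zero hp hk
  have hζi : (z - m) / k = ζ⁻¹ := by
    rw [hζ, inv_div, div_eq_div_iff hk hp, ← pow_two, ← hzz]; ring
  have hΦ : ‖Phi m z‖ = ‖ζ‖ ^ 2 := by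
    rw [← norm_pow, hζ, div_pow, ← hzz, Phi]
    congr 1
    field_simp
  have hεn : ‖ε‖ = 1 := by
    have := congrArg norm hε
    rw [norm_pow, norm_one] at this
    exact (pow_eq_one_iff_of_nonneg (norm_nonneg _) two_ne_zero).1 this
  have hζn : 0 < ‖ζ‖ := norm_pos_iff.2 hζ0
  refine ContinuousLinearMap.opNorm_le_bound _ (eta_pos (norm_nonneg _)).le fun v => ?_
  have hv : ‖v‖ ^ 2 = ‖v 0‖ ^ 2 + ‖v 1‖ ^ 2 := by
    rw [EuclideanSpace.norm_sq_eq, Fin.sum_univ_two]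
  have h0 : matOp (greenMatrix m z k ε) v 0 = Complex.I / 2 * (ζ * (v 0 + ε * ζ⁻¹ * v 1)) := by
    rw [matOp_apply]
    simp only [greenMatrix, ← hζ, Matrix.of_apply, Matrix.cons_val_zero, Matrix.cons_val_one]
    field_simp
  have h1 : matOp (greenMatrix m z k ε) v 1 = Complex.I / 2 * (ε * (v 0 + ε * ζ⁻¹ * v 1)) := by
    rw [matOp_apply]
    simp only [greenMatrix, hζi, Matrix.of_apply, Matrix.cons_val_zero, Matrix.cons_val_one]
    linear_combination (-(Complex.I / 2) * ζ⁻¹ * v 1) * hε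
  have hI : ‖Complex.I / 2‖ = 1 / 2 := by simp
  have hw : ‖v 0 + ε * ζ⁻¹ * v 1‖ ≤ ‖v 0‖ + ‖ζ‖⁻¹ * ‖v 1‖ := by
    refine (norm_add_le _ _).trans ?_
    rw [norm_mul, norm_mul, hεn, norm_inv, one_mul]
  have hw2 : ‖v 0 + ε * ζ⁻¹ * v 1‖ ^ 2 ≤ (1 + (‖ζ‖⁻¹) ^ 2) * ‖v‖ ^ 2 := by
    refine (pow_le_pow_left₀ (norm_nonneg _) hw 2).trans ?_
    rw [hv]
    -- The square is the defect in the Cauchy–Schwarz inequality for `(1, ‖ζ‖⁻¹)` and `(‖v 0‖, ‖v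
    -- 1‖)`.
    nlinarith [sq_nonneg (‖v 1‖ - ‖ζ‖⁻¹ * ‖v 0‖)]
  have heta : eta ‖Phi m z‖ ^ 2 = 1 / 4 * ((‖ζ‖ ^ 2 + 1) * (1 + (‖ζ‖⁻¹) ^ 2)) := by
    rw [eta, Real.sq_sqrt (by positivity), hΦ]
    field_simp
    ring
  refine le_of_sq_le_sq ?_ (mul_nonneg (eta_pos (norm_nonneg _)).le (norm_nonneg _))
  rw [mul_pow, heta, EuclideanSpace.norm_sq_eq, Fin.sum_univ_two, h0, h1, norm_mul, norm_mul,
    norm_mul, norm_mul, hI, hεn]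
  calc (1 / 2 * (‖ζ‖ * ‖v 0 + ε * ζ⁻¹ * v 1‖)) ^ 2 + (1 / 2 * (1 * ‖v 0 + ε * ζ⁻¹ * v 1‖)) ^ 2
      = 1 / 4 * (‖ζ‖ ^ 2 + 1) * ‖v 0 + ε * ζ⁻¹ * v 1‖ ^ 2 := by ring
    _ ≤ 1 / 4 * (‖ζ‖ ^ 2 + 1) * ((1 + (‖ζ‖⁻¹) ^ 2) * ‖v‖ ^ 2) := by gcongr
    _ = _ := by ring

lemma stronglyMeasurable_greenKernel : StronglyMeasurable (greenKernel m z k) := by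
  unfold greenKernel
  refine StronglyMeasurable.ite measurableSet_Ioi ?_ ?_ <;>
  exact Continuous.stronglyMeasurable (by fun_prop)

theorem isExpKernel_greenKernel (hk : 0 < k.im) (hkz : k ^ 2 = z ^ 2 - (m : ℂ) ^ 2) :
    IsExpKernel (greenKernel m z k) (eta ‖Phi m z‖).toNNReal k.im where
  pos := hk
  meas := stronglyMeasurable_greenKernel
  bound := by
    intro t
    have hk0 : k ≠ 0 := fun h => by simp [h] at hk
    have h : ‖greenKernel m z k t‖ ≤ eta ‖Phi m z‖ * Real.exp (-k.im * |t|) := by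
      unfold greenKernel
      split_ifs with ht
      · rw [norm_smul, mul_comm, Complex.norm_exp, abs_of_pos ht]
        refine mul_le_mul (norm_greenMatrix_le hk0 hkz (by norm_num)) (le_of_eq ?_)
          (Real.exp_pos _).le (eta_pos (norm_nonneg _)).le
        simp
      · rw [norm_smul, mul_comm, Complex.norm_exp, abs_of_nonpos (not_lt.1 ht)]
        refine mul_le_mul (norm_greenMatrix_le hk0 hkz (by norm_num)) (le_of_eq ?_)
          (Real.exp_pos _).le (eta_pos (norm_nonneg _)).le
        simp
    rw [← ofReal_norm]
    refine (ENNReal.ofReal_le_ofReal h).trans (le_of_eq ?_)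
    rw [ENNReal.ofReal_mul (eta_pos (norm_nonneg _)).le]
    rfl

/-- Away from `t = 0` the kernel satisfies `N' = i σ₁ (z - m σ₃) N`, and it jumps by `i σ₁` at
`0`. This is the weak form of the two facts. -/
lemma integral_test_greenKernel (hk : k ≠ 0) (hkz : k ^ 2 = z ^ 2 - (m : ℂ) ^ 2) {φ : ℝ → ℝ}
    (hφ : ContDiff ℝ ∞ φ) (hc : HasCompactSupport φ) (y : ℝ) (v : Spinor) :
    ∫ x, (deriv φ x • greenKernel m z k (x - y) v +
        φ x • matOp (odeMatrix m z) (greenKernel m z k (x - y) v)) =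
      -(φ y • matOp (Complex.I • !![0, 1; 1, 0]) v) := by
  -- On each side of `y` the integrand is the derivative of `F = φ · e^{ikε(x-y)} G_ε v`, which is
  -- smooth enough on the whole line and compactly supported. Each half-line integral thus reduces
  -- to the value at `y`.
  have key : ∀ ε : ℂ, ε ^ 2 = 1 → ∃ F : ℝ → Spinor, ContDiff ℝ 1 F ∧ HasCompactSupport F ∧
      F y = φ y • matOp (greenMatrix m z k ε) v ∧ ∀ x, deriv F x =
        deriv φ x • Complex.exp (Complex.I * k * ε * (x - y)) • matOp (greenMatrix m z k ε) v +
        φ x • matOp (odeMatrix m z)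
          (Complex.exp (Complex.I * k * ε * (x - y)) • matOp (greenMatrix m z k ε) v) := by
    intro ε hε
    have hφ1 : ContDiff ℝ 1 φ := hφ.of_le (by simp)
    have he : ∀ x : ℝ, HasDerivAt (fun x : ℝ => Complex.exp (Complex.I * k * ε * (x - y)))
        (Complex.exp (Complex.I * k * ε * (x - y)) * (Complex.I * k * ε)) x := by
      intro x
      have h1 : HasDerivAt (fun x : ℂ => Complex.I * k * ε * (x - y)) (Complex.I * k * ε) x := by
        simpa using ((hasDerivAt_id (x : ℂ)).sub_const (y : ℂ)).const_mul (Complex.I * k * ε)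
      exact h1.cexp.comp_ofReal
    have hec : ContDiff ℝ 1 (fun x : ℝ => Complex.exp (Complex.I * k * ε * (x - y))) := by
      have : ContDiff ℝ 1 (fun x : ℝ => (x : ℂ)) := Complex.ofRealCLM.contDiff
      fun_prop
    refine ⟨fun x => φ x • Complex.exp (Complex.I * k * ε * (x - y)) •
      matOp (greenMatrix m z k ε) v, ?_, ?_, ?_, ?_⟩
    · exact hφ1.smul (hec.smul contDiff_const)
    · exact hc.smul_right
    · simp
    · intro x
      have h1 := (hφ1.differentiable one_ne_zero x).hasDerivAt.smul
        ((he x).smul_const (matOp (greenMatrix m z k ε) v))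
      refine h1.deriv.trans ?_
      rw [map_smul, ← matOp_mul_apply, odeMatrix_mul_greenMatrix hk hkz hε,
        matOp_smul_apply, smul_smul (Complex.exp _), add_comm]
  obtain ⟨F, hF1, hF2, hF3, hF4⟩ := key 1 (by norm_num)
  obtain ⟨F', hF1', hF2', hF3', hF4'⟩ := key (-1) (by norm_num)
  have e1 : EqOn (deriv F) (fun x => deriv φ x • greenKernel m z k (x - y) v +
        φ x • matOp (odeMatrix m z) (greenKernel m z k (x - y) v)) (Ioi y) := by
    intro x hx
    have hx' : 0 < x - y := sub_pos.2 hx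
    dsimp only
    rw [hF4, greenKernel, if_pos hx', mul_one]
    push_cast
    rfl
  have e2 : EqOn (deriv F') (fun x => deriv φ x • greenKernel m z k (x - y) v +
        φ x • matOp (odeMatrix m z) (greenKernel m z k (x - y) v)) (Iic y) := by
    intro x hx
    have hx' : ¬ 0 < x - y := not_lt.2 (sub_nonpos.2 hx)
    dsimp only
    rw [hF4', greenKernel, if_neg hx', mul_neg_one, neg_mul]
    push_cast
    rfl
  have i1 : IntegrableOn (deriv F) (Ioi y) :=
    ((hF1.continuous_deriv le_rfl).integrable_of_hasCompactSupport hF2.deriv).integrableOn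
  have i2 : IntegrableOn (deriv F') (Iic y) :=
    ((hF1'.continuous_deriv le_rfl).integrable_of_hasCompactSupport hF2'.deriv).integrableOn
  rw [← intervalIntegral.integral_Iic_add_Ioi (b := y) (i2.congr_fun e2 measurableSet_Iic)
    (i1.congr_fun e1 measurableSet_Ioi), ← setIntegral_congr_fun measurableSet_Iic e2,
    ← setIntegral_congr_fun measurableSet_Ioi e1, hF2.integral_Ioi_deriv_eq hF1,
    hF2'.integral_Iic_deriv_eq hF1', hF3, hF3', ← sub_eq_add_neg, ← smul_sub, ← neg_sub,
    smul_neg]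
  -- The jump of the kernel at `0`: `G_1 - G_{-1} = i σ₁`.
  congr 2
  ext i
  fin_cases i <;> simp [matOp_apply, greenMatrix] <;> ring

end Green

/-! ### The free resolvent -/

lemma lintegral_expWeight_lt_top {s : ℝ} (hs : 0 < s) : ∫⁻ x, expWeight s x < ⊤ := by
  have h : Integrable fun x : ℝ => Real.exp (-s * |x|) :=
    by
    rw [← integrableOn_univ, ← Iic_union_Ioi (a := (0 : ℝ))]
    refine IntegrableOn.union ?_ ?_
    · refine (integrableOn_exp_mul_Iic hs 0).congr_fun (fun x hx => ?_) measurableSet_Iic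
      dsimp only
      rw [abs_of_nonpos hx, neg_mul_neg]
    · refine (exp_neg_integrableOn_Ioi 0 hs).congr_fun (fun x hx => ?_) measurableSet_Ioi
      dsimp only
      rw [abs_of_pos hx]
  exact h.lintegral_lt_top

/-- The constant function `1` is exponentially bounded. -/
lemma exists_isExpBounded_one {s : ℝ} (hs : 0 < s) :
    ∃ C, IsExpBounded (fun _ => (1 : Spinor →L[ℂ] Spinor)) s C := by
  refine ⟨(∫⁻ x, expWeight s x).toNNReal, aestronglyMeasurable_const, fun x => ?_⟩
  rw [ENNReal.coe_toNNReal (lintegral_expWeight_lt_top hs).ne]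
  simp only [enorm_one, one_pow, one_mul]
  exact (lintegral_sub_right_eq_self (expWeight s) x).le

section Kernel

variable {N b : ℝ → Spinor →L[ℂ] Spinor} {c Cb : ℝ≥0} {s : ℝ}

/-- The inner integral over `y` is bounded uniformly in `x`, and `ψ` is integrable. This justifies
Fubini when the kernel is tested against `φ` and `φ'`. -/
lemma IsExpKernel.integrable_prod (hN : IsExpKernel N c s) (hb : IsExpBounded b s Cb)
    (g : StateSpace) {ψ : ℝ → ℝ} (hψ : Integrable ψ) :
    Integrable (fun p : ℝ × ℝ => ψ p.1 • N (p.1 - p.2) (b p.2 ((g : ℝ → Spinor) p.2)))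
      ((volume : Measure ℝ).prod volume) := by
  have hm : AEStronglyMeasurable
      (fun p : ℝ × ℝ => ψ p.1 • N (p.1 - p.2) (b p.2 ((g : ℝ → Spinor) p.2)))
      ((volume : Measure ℝ).prod volume) :=
    hψ.1.comp_fst.smul (hN.aestronglyMeasurable_prod hb (Lp.aestronglyMeasurable g))
  refine ⟨hm, ?_⟩
  set C := (c ^ 2 * Cb * ∫⁻ y, ‖(g : ℝ → Spinor) y‖ₑ ^ 2) ^ (2 : ℝ)⁻¹ with hC
  have hCtop : C < ⊤ := by
    refine ENNReal.rpow_lt_top_of_nonneg (by norm_num) ?_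
    exact (ENNReal.mul_lt_top (by finiteness) (lintegral_enorm_sq_lt_top g)).ne
  have hle : ∀ x, ∫⁻ y, ‖N (x - y) (b y ((g : ℝ → Spinor) y))‖ₑ ≤ C := by
    intro x
    rw [hC, ENNReal.le_rpow_inv_iff two_pos, ENNReal.rpow_two]
    refine (hN.sq_lintegral_le hb (Lp.aestronglyMeasurable g) x).trans (mul_le_mul_right ?_ _)
    exact lintegral_mono fun y => mul_le_of_le_one_right' (expWeight_le_one hN.pos.le _)
  rw [HasFiniteIntegral, lintegral_prod _ hm.enorm]
  calc ∫⁻ x, ∫⁻ y, ‖ψ x • N (x - y) (b y ((g : ℝ → Spinor) y))‖ₑ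
      ≤ ∫⁻ x, ‖ψ x‖ₑ * C := by
        refine lintegral_mono fun x => ?_
        simp only [enorm_smul]
        rw [lintegral_const_mul' _ _ enorm_ne_top]
        exact mul_le_mul_right (hle x) _
    _ = (∫⁻ x, ‖ψ x‖ₑ) * C := lintegral_mul_const' _ _ hCtop.ne
    _ < ⊤ := ENNReal.mul_lt_top hψ.2 hCtop

end Kernel

section Free

variable {m : ℝ} {z k : ℂ}

/-- The weak derivative of `N * g`, for the kernel `N` of the free resolvent. -/
lemma hasWeakDeriv_greenKernel (hk : 0 < k.im) (hkz : k ^ 2 = z ^ 2 - (m : ℂ) ^ 2)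
    (f g : StateSpace)
    (hf : (f : ℝ → Spinor) =ᵐ[volume] kerInt (greenKernel m z k) (fun _ => 1) g) :
    HasWeakDeriv f (constOp (Complex.I • !![0, 1; 1, 0]) g + constOp (odeMatrix m z) f) := by
  intro φ hφ hc
  have hk0 : k ≠ 0 := fun h => by simp [h] at hk
  have hN := isExpKernel_greenKernel hk hkz
  obtain ⟨C, hC⟩ := exists_isExpBounded_one hk
  set N := greenKernel m z k with hNdef
  set M := matOp (odeMatrix m z) with hM
  set J := matOp (Complex.I • !![0, 1; 1, 0]) with hJ
  have hφ1 : ContDiff ℝ 1 φ := hφ.of_le (by simp)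
  have hd : Continuous (deriv φ) := hφ1.continuous_deriv le_rfl
  have hiφ : Integrable φ := hφ.continuous.integrable_of_hasCompactSupport hc
  have hiφ' : Integrable (deriv φ) := hd.integrable_of_hasCompactSupport hc.deriv
  have i1 := hN.integrable_prod hC g hiφ'
  have i2 := M.integrable_comp (hN.integrable_prod hC g hiφ)
  have hsec : ∀ x, Integrable fun y => N (x - y) ((g : ℝ → Spinor) y) :=
    fun x => hN.integrable_section hC g x
  have if1 : Integrable fun x => deriv φ x • (f : ℝ → Spinor) x := integrable_test_smul hd hc.deriv f
  have if2 : Integrable fun x => φ x • M ((f : ℝ → Spinor) x) := by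
    refine (M.integrable_comp (integrable_test_smul hφ.continuous hc f)).congr ?_
    refine Eventually.of_forall fun x => ?_
    exact M.map_smul_of_tower _ _
  have ig : Integrable fun x => φ x • J ((g : ℝ → Spinor) x) := by
    refine (J.integrable_comp (integrable_test_smul hφ.continuous hc g)).congr ?_
    refine Eventually.of_forall fun x => ?_
    exact J.map_smul_of_tower _ _
  have key : ∫ x, (deriv φ x • (f : ℝ → Spinor) x + φ x • M ((f : ℝ → Spinor) x)) =
      -∫ y, φ y • J ((g : ℝ → Spinor) y) := by
    calc ∫ x, (deriv φ x • (f : ℝ → Spinor) x + φ x • M ((f : ℝ → Spinor) x))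
        = ∫ x, ∫ y, (deriv φ x • N (x - y) ((g : ℝ → Spinor) y) +
            M (φ x • N (x - y) ((g : ℝ → Spinor) y))) := by
          refine integral_congr_ae ?_
          filter_upwards [hf] with x hx
          have e : ∫ y, M (φ x • N (x - y) ((g : ℝ → Spinor) y)) =
              M (∫ y, φ x • N (x - y) ((g : ℝ → Spinor) y)) :=
            M.integral_comp_comm ((hsec x).smul (φ x))
          have e' := integral_add ((hsec x).smul (deriv φ x))
            (M.integrable_comp ((hsec x).smul (φ x)))
          refine Eq.trans ?_ e'.symm
          simp only [Pi.smul_apply]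
          rw [e, integral_smul, integral_smul, hx, M.map_smul_of_tower]
          rfl
      _ = ∫ y, ∫ x, (deriv φ x • N (x - y) ((g : ℝ → Spinor) y) +
            M (φ x • N (x - y) ((g : ℝ → Spinor) y))) := by
          refine integral_integral_swap ?_
          exact i1.add i2
      _ = ∫ y, -(φ y • J ((g : ℝ → Spinor) y)) := by
          refine integral_congr_ae (Eventually.of_forall fun y => ?_)
          dsimp only
          rw [hJ, ← integral_test_greenKernel hk0 hkz hφ hc y ((g : ℝ → Spinor) y)]
          simp only [M.map_smul_of_tower]
          rfl
      _ = _ := integral_neg _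
  rw [integral_add if1 if2] at key
  rw [eq_sub_of_add_eq key, neg_sub_left, ← integral_add if2 ig]
  congr 1
  refine integral_congr_ae ?_
  filter_upwards [Lp.coeFn_add (constOp (Complex.I • !![0, 1; 1, 0]) g) (constOp (odeMatrix m z) f),
    constOp_ae (Complex.I • !![0, 1; 1, 0]) g, constOp_ae (odeMatrix m z) f] with x h1 h2 h3
  rw [h1, Pi.add_apply, h2, h3, smul_add, add_comm]

/-- The solution is `e^{lx} p(0)`, which is unbounded in the direction of the sign of `Re l` unless
`p(0) = 0`. -/
lemma eq_zero_of_hasDerivAt_of_bounded {l : ℂ} (hl : l.re ≠ 0) {p : ℝ → Spinor}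
    (hp : ∀ x, HasDerivAt p (l • p x) x) {C : ℝ} (hC : ∀ x, ‖p x‖ ≤ C) : p 0 = 0 := by
  have he : ∀ x : ℝ, HasDerivAt (fun x : ℝ => Complex.exp (-l * x))
      (Complex.exp (-l * x) * (-l)) x := by
    intro x
    have h1 : HasDerivAt (fun x : ℂ => -l * x) (-l) x := by
      simpa using (hasDerivAt_id (x : ℂ)).const_mul (-l)
    exact h1.cexp.comp_ofReal
  have hd : ∀ x : ℝ, HasDerivAt (fun x : ℝ => Complex.exp (-l * x) • p x) 0 x := by
    intro x
    refine ((he x).smul (hp x)).congr_deriv ?_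
    rw [smul_smul, ← add_smul]
    simp
  have hconst : ∀ x : ℝ, Complex.exp (-l * x) • p x = p 0 := by
    intro x
    have h := is_const_of_deriv_eq_zero (fun x => (hd x).differentiableAt)
      (fun x => (hd x).deriv) x 0
    simpa using h
  by_contra h0
  have hn : 0 < ‖p 0‖ := norm_pos_iff.2 h0
  have hl2 : 0 < l.re ^ 2 := by positivity
  -- At `x = t Re l` one has `|e^{lx}| ≥ 1 + t (Re l)²`, so `‖p x‖ ≥ ‖p 0‖ + C > C`.
  set t := C / (l.re ^ 2 * ‖p 0‖) with ht
  have h1 := hconst (t * l.re)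
  have h2 : p (t * l.re) = Complex.exp (l * (t * l.re : ℝ)) • p 0 := by
    rw [← h1, smul_smul, ← Complex.exp_add]
    simp
  have h3 := hC (t * l.re)
  rw [h2, norm_smul, Complex.norm_exp, Complex.re_mul_ofReal] at h3
  have h4 := Real.add_one_le_exp (l.re * (t * l.re))
  have h5 : l.re * (t * l.re) * ‖p 0‖ = C := by
    rw [ht]; field_simp
  nlinarith

/-- By Cauchy–Schwarz, the convolution of two `L²` functions is bounded. -/
lemma exists_bound_convolution (f : StateSpace) {φ : ℝ → ℝ} (hφ : Continuous φ)
    (hc : HasCompactSupport φ) : ∃ C : ℝ, ∀ x, ‖∫ y, φ (x - y) • (f : ℝ → Spinor) y‖ ≤ C := by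
  have hφ2 : ∫⁻ x, ‖φ x‖ₑ ^ 2 < ⊤ := by
    have h := (hφ.memLp_of_hasCompactSupport (p := 2) (μ := (volume : Measure ℝ)) hc).2
    have e := eLpNorm_nnreal_pow_eq_lintegral (f := φ) (μ := (volume : Measure ℝ)) (p := 2)
      (by simp)
    have e' : ∫⁻ x, ‖φ x‖ₑ ^ 2 = eLpNorm φ 2 volume ^ 2 := by simpa using e.symm
    rw [e']
    exact ENNReal.pow_lt_top h
  have hL : (∫⁻ x, ‖φ x‖ₑ ^ 2) * ∫⁻ y, ‖(f : ℝ → Spinor) y‖ₑ ^ 2 < ⊤ :=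
    ENNReal.mul_lt_top hφ2 (lintegral_enorm_sq_lt_top f)
  refine ⟨(((∫⁻ x, ‖φ x‖ₑ ^ 2) * ∫⁻ y, ‖(f : ℝ → Spinor) y‖ₑ ^ 2) ^ (2 : ℝ)⁻¹).toReal,
    fun x => ?_⟩
  rw [← toReal_enorm]
  refine ENNReal.toReal_mono (ENNReal.rpow_lt_top_of_nonneg (by norm_num) hL.ne).ne ?_
  rw [ENNReal.le_rpow_inv_iff two_pos, ENNReal.rpow_two]
  have hm : Continuous fun y => φ (x - y) := hφ.comp (by fun_prop)
  have h1 := lintegral_mul_sq_le (f := fun y => ‖φ (x - y)‖ₑ) hm.enorm.aemeasurable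
    (Lp.aestronglyMeasurable f).enorm
  rw [lintegral_sub_left_eq_self (fun y => ‖φ y‖ₑ ^ 2) x] at h1
  refine (pow_le_pow_left' ((enorm_integral_le_lintegral_enorm _).trans (le_of_eq ?_)) 2).trans h1
  exact lintegral_congr fun y => enorm_smul _ _

/-- An `L²` function that satisfies `f' = i σ₁ (z - m σ₃) f` vanishes. -/
lemma eq_zero_of_hasWeakDeriv (hk : 0 < k.im) (hkz : k ^ 2 = z ^ 2 - (m : ℂ) ^ 2)
    {f : StateSpace} (hf : HasWeakDeriv f (constOp (odeMatrix m z) f)) : f = 0 := by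
  have hk0 : k ≠ 0 := fun h => by simp [h] at hk
  set M := matOp (odeMatrix m z) with hM
  have hMM : ∀ v, M (M v) = (-k ^ 2) • v := by
    intro v
    rw [hM, ← matOp_mul_apply, odeMatrix_sq, matOp_smul_apply, matOp_one_apply, hkz]
  have hloc : LocallyIntegrable (f : ℝ → Spinor) volume := (Lp.memLp f).locallyIntegrable (by norm_num)
  refine (Lp.eq_zero_iff_ae_eq_zero).2 ?_
  refine ae_eq_zero_of_integral_contDiff_smul_eq_zero hloc fun φ₀ hφ₀ hc₀ => ?_
  -- The test function is reflected so that the mollification `u = φ * f` has `u 0 = ∫ φ₀ f`.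
  -- Mollifying turns the weak equation into the classical `u' = M u` with `u` bounded.
  set φ : ℝ → ℝ := fun x => φ₀ (-x) with hφdef
  have hφ : ContDiff ℝ ∞ φ := hφ₀.comp contDiff_neg
  have hc : HasCompactSupport φ := hc₀.comp_homeomorph (Homeomorph.neg ℝ)
  have hφ1 : ContDiff ℝ 1 φ := hφ.of_le (by simp)
  set u : ℝ → Spinor := fun x => ∫ y, φ (x - y) • (f : ℝ → Spinor) y with hu
  have hu' : ∀ x, HasDerivAt u (M (u x)) x := by
    intro x
    have h := hc.hasDerivAt_convolution_right (ContinuousLinearMap.lsmul ℝ ℝ).flip (μ := volume)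
      hloc hφ1 x
    simp only [convolution_def, ContinuousLinearMap.flip_apply, ContinuousLinearMap.lsmul_apply] at h
    refine h.congr_deriv ?_
    have hψ : ContDiff ℝ ∞ fun y => φ (x - y) := hφ.comp (contDiff_const.sub contDiff_id)
    have hψc : HasCompactSupport fun y => φ (x - y) := hc.comp_homeomorph (Homeomorph.subLeft x)
    have hw := hf _ hψ hψc
    have hder : ∀ y, deriv (fun y => φ (x - y)) y = - deriv φ (x - y) := by
      intro y
      exact deriv_comp_const_sub _ _ _
    simp only [hder, neg_smul, integral_neg, neg_inj] at hw
    rw [hw, hu]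
    dsimp only
    rw [← M.integral_comp_comm (integrable_test_smul hψ.continuous hψc f)]
    refine integral_congr_ae ?_
    filter_upwards [constOp_ae (odeMatrix m z) f] with y hy
    rw [hy, M.map_smul_of_tower]
  obtain ⟨C, hC⟩ := exists_bound_convolution f hφ.continuous hc
  -- Since `M² = -k² = l²`, the combination `p = M u + l u` satisfies `p' = l p` and is bounded. For
  -- `l = ±ik` the real part is `∓Im k ≠ 0`, so both combinations vanish at `0`; their difference is
  -- `2ik u(0)`.
  have hp : ∀ l : ℂ, l.re ≠ 0 → l ^ 2 = -k ^ 2 → M (u 0) + l • u 0 = 0 := by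
    intro l hl hl2
    refine eq_zero_of_hasDerivAt_of_bounded hl (p := fun x => M (u x) + l • u x)
      (C := ‖M‖ * C + ‖l‖ * C) (fun x => ?_) (fun x => ?_)
    · have h1 : HasDerivAt (fun x => M (u x)) (M (M (u x))) x :=
        (M.restrictScalars ℝ).hasFDerivAt.comp_hasDerivAt x (hu' x)
      refine (h1.add ((hu' x).const_smul l)).congr_deriv ?_
      rw [hMM, ← hl2, smul_add, smul_smul, pow_two, add_comm]
    · refine (norm_add_le _ _).trans (add_le_add ?_ ?_)
      · exact (M.le_opNorm _).trans (mul_le_mul_of_nonneg_left (hC x) (norm_nonneg _))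
      · rw [norm_smul]
        exact mul_le_mul_of_nonneg_left (hC x) (norm_nonneg _)
  have h1 := hp (Complex.I * k) (by simpa using hk.ne') (by rw [mul_pow, Complex.I_sq]; ring)
  have h2 := hp (-(Complex.I * k)) (by simpa using hk.ne') (by rw [neg_sq, mul_pow, Complex.I_sq]; ring)
  have h3 : (2 * (Complex.I * k)) • u 0 = 0 := by
    have := congrArg₂ (· - ·) h1 h2
    simp only [sub_zero] at this
    rw [← this, two_mul, add_smul, neg_smul]
    abel
  have h4 : u 0 = 0 := (smul_eq_zero.1 h3).resolve_left (by simp [hk0])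
  rw [← h4, hu]
  simp [hφdef]

lemma mem_graph_freeDirac (m : ℝ) (f h : StateSpace) :
    (f, h) ∈ (freeDirac m).graph ↔ ∃ g, HasWeakDeriv f g ∧
      h = constOp ((m : ℂ) • !![1, 0; 0, -1]) f + constOp ((-Complex.I) • !![0, 1; 1, 0]) g := by
  rw [LinearPMap.mem_graph_iff]
  constructor
  · rintro ⟨y, rfl, rfl⟩
    exact ⟨weakDeriv y, (mem_graph_weakDeriv _ _).1 (weakDeriv.mem_graph y), rfl⟩
  · rintro ⟨g, hg, rfl⟩
    rw [← mem_graph_weakDeriv, LinearPMap.mem_graph_iff] at hg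
    obtain ⟨y, rfl, rfl⟩ := hg
    exact ⟨y, rfl, rfl⟩

/-- Algebraically, this makes `f' = i σ₁ (z - m σ₃) f` equivalent to `H₀ f = z f`. -/
lemma freeDirac_matrix_identity (m : ℝ) (z : ℂ) :
    (m : ℂ) • !![1, 0; 0, -1] + ((-Complex.I) • !![0, 1; 1, 0]) * odeMatrix m z =
      z • (1 : Matrix (Fin 2) (Fin 2) ℂ) := by
  ext i j
  fin_cases i <;> fin_cases j <;> simp [odeMatrix] <;> ring_nf <;> simp

lemma pauli_mul_pauli :
    ((-Complex.I) • !![0, 1; 1, 0]) * (Complex.I • !![0, 1; 1, 0]) =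
      (1 : ℂ) • (1 : Matrix (Fin 2) (Fin 2) ℂ) := by
  ext i j
  fin_cases i <;> fin_cases j <;> simp

/-- The integral operator with kernel `N(x - y)` is the resolvent of the free Dirac operator. -/
theorem isResolventAt_freeDirac (hk : 0 < k.im) (hkz : k ^ 2 = z ^ 2 - (m : ℂ) ^ 2)
    {R : StateSpace →L[ℂ] StateSpace}
    (hR : ∀ g : StateSpace, (R g : ℝ → Spinor) =ᵐ[volume] kerInt (greenKernel m z k) (fun _ => 1) g) :
    IsResolventAt (freeDirac m) z R := by
  have h2 : ∀ g, (R g, g + z • R g) ∈ (freeDirac m).graph := by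
    intro g
    rw [mem_graph_freeDirac]
    refine ⟨_, hasWeakDeriv_greenKernel hk hkz (R g) g (hR g), ?_⟩
    rw [map_add, ← constOp_mul_apply, ← constOp_mul_apply, pauli_mul_pauli,
      ← constOp_smul_one_apply z, ← freeDirac_matrix_identity m z, constOp_add_apply,
      constOp_smul_one_apply, one_smul]
    abel
  -- The right inverse is in hand; injectivity of `H₀ - z` upgrades it to a two-sided one.
  have hker : ∀ f, (f, z • f) ∈ (freeDirac m).graph → f = 0 := by
    intro f hf
    rw [mem_graph_freeDirac] at hf
    obtain ⟨g, hg, he⟩ := hf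
    have e1 : constOp ((-Complex.I) • !![0, 1; 1, 0]) g =
        constOp ((-Complex.I) • !![0, 1; 1, 0]) (constOp (odeMatrix m z) f) := by
      rw [← constOp_smul_one_apply z, ← freeDirac_matrix_identity m z, constOp_add_apply,
        constOp_mul_apply] at he
      exact (add_left_cancel he).symm
    have e2 : (Complex.I • !![0, 1; 1, 0]) * ((-Complex.I) • !![0, 1; 1, 0]) =
        (1 : ℂ) • (1 : Matrix (Fin 2) (Fin 2) ℂ) := by
      rw [← pauli_mul_pauli]; simp
    have e3 := congrArg (constOp (Complex.I • !![0, 1; 1, 0])) e1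
    rw [← constOp_mul_apply, ← constOp_mul_apply _ _ (constOp (odeMatrix m z) f), e2,
      constOp_smul_one_apply, constOp_smul_one_apply, one_smul, one_smul] at e3
    rw [e3] at hg
    exact eq_zero_of_hasWeakDeriv hk hkz hg
  refine (isResolventAt_iff_graph _ _ _).2 ⟨fun f h hfh => ?_, h2⟩
  rw [← sub_eq_zero]
  refine hker _ ?_
  have := (freeDirac m).graph.sub_mem (h2 (h - z • f)) hfh
  rw [Prod.mk_sub_mk] at this
  convert this using 2
  rw [smul_sub]
  abel

end Free

/-! ### Multiplication operators -/

section Multiplication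

variable {M : ℝ → Spinor →L[ℂ] Spinor}

lemma mem_graph_mulOp (f h : StateSpace) :
    (f, h) ∈ (mulOp M).graph ↔ (h : ℝ → Spinor) =ᵐ[volume] fun x => M x ((f : ℝ → Spinor) x) := by
  rw [LinearPMap.mem_graph_iff]
  constructor
  · rintro ⟨y, rfl, rfl⟩
    exact MemLp.coeFn_toLp (memLp_of_mem_mulDomain y.2)
  · intro hh
    have hf : f ∈ mulDomain M := (Lp.memLp h).ae_eq hh
    refine ⟨⟨f, hf⟩, rfl, Lp.ext ?_⟩
    exact (MemLp.coeFn_toLp (memLp_of_mem_mulDomain hf)).trans hh.symm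

lemma exists_subseq_tendsto_ae {f : ℕ → StateSpace} {g : StateSpace}
    (h : Tendsto f atTop (𝓝 g)) : ∃ ns : ℕ → ℕ, StrictMono ns ∧
      ∀ᵐ x ∂volume, Tendsto (fun i => (f (ns i) : ℝ → Spinor) x) atTop (𝓝 ((g : ℝ → Spinor) x)) :=
  (tendstoInMeasure_of_tendsto_Lp h).exists_seq_tendsto_ae

/-- Convergence in `L²` gives almost everywhere convergence along a subsequence, and the relation `h
= M f` passes to the limit pointwise. -/
lemma isClosed_mulOp : (mulOp M).IsClosed := by
  refine IsSeqClosed.isClosed fun p q hp hq => ?_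
  obtain ⟨f, h⟩ := q
  have h1 : Tendsto (fun n => (p n).1) atTop (𝓝 f) := (continuous_fst.tendsto _).comp hq
  have h2 : Tendsto (fun n => (p n).2) atTop (𝓝 h) := (continuous_snd.tendsto _).comp hq
  obtain ⟨ns, hns, hae1⟩ := exists_subseq_tendsto_ae h1
  -- The second subsequence is taken inside the first, so that both components converge along it.
  obtain ⟨ms, hms, hae2⟩ := exists_subseq_tendsto_ae (h2.comp hns.tendsto_atTop)
  refine (mem_graph_mulOp f h).2 ?_
  have hall : ∀ᵐ x ∂volume, ∀ n, ((p n).2 : ℝ → Spinor) x = M x (((p n).1 : ℝ → Spinor) x) :=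
    ae_all_iff.2 fun n => (mem_graph_mulOp _ _).1 (hp n)
  filter_upwards [hae1, hae2, hall] with x hx1 hx2 hx3
  refine tendsto_nhds_unique hx2 ?_
  simp only [Function.comp_apply, hx3]
  exact ((M x).continuous.tendsto _).comp (hx1.comp hms.tendsto_atTop)

/-- Truncating `f` to `{‖M‖ ≤ n}` lands in the domain and converges to `f` by dominated convergence.
The sets use a measurable representative of `M`. -/
lemma dense_domain_mulOp (hM : AEStronglyMeasurable M volume) :
    Dense ((mulOp M).domain : Set StateSpace) := by
  intro f
  set S : ℕ → Set ℝ := fun n => {x | ‖hM.mk M x‖ ≤ n} with hS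
  have hSm : ∀ n, MeasurableSet (S n) := fun n =>
    measurableSet_le hM.stronglyMeasurable_mk.norm.measurable measurable_const
  have hmem : ∀ n, MemLp ((S n).indicator (f : ℝ → Spinor)) 2 volume := fun n =>
    (Lp.memLp f).indicator (hSm n)
  have hdom : ∀ n, (hmem n).toLp ∈ (mulOp M).domain := by
    intro n
    have hle : MemLp (fun x => hM.mk M x ((S n).indicator (f : ℝ → Spinor) x)) 2 volume := by
      refine MemLp.of_le_mul (c := n) (hmem n)
        (aestronglyMeasurable_apply hM.stronglyMeasurable_mk.aestronglyMeasurable (hmem n).1)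
        (Eventually.of_forall fun x => ?_)
      by_cases hx : x ∈ S n
      · exact ((hM.mk M x).le_opNorm _).trans
          (mul_le_mul_of_nonneg_right hx (norm_nonneg _))
      · simp [hx]
    refine hle.ae_eq ?_
    filter_upwards [(hmem n).coeFn_toLp, hM.ae_eq_mk] with x h1 h2
    rw [h1, h2]
  have hlim : Tendsto (fun n => (hmem n).toLp) atTop (𝓝 ((Lp.memLp f).toLp (f : ℝ → Spinor))) := by
    rw [Lp.tendsto_Lp_iff_tendsto_eLpNorm'']
    have hsq : Tendsto (fun n => ∫⁻ x, ‖((S n).indicator (f : ℝ → Spinor) - (f : ℝ → Spinor)) x‖ₑ ^ 2)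
        atTop (𝓝 (∫⁻ _ : ℝ, 0)) := by
      refine tendsto_lintegral_of_dominated_convergence' (fun x => ‖(f : ℝ → Spinor) x‖ₑ ^ 2)
        (fun n => (((hmem n).1.sub (Lp.aestronglyMeasurable f)).enorm.pow_const 2)) (fun n => ?_)
        (lintegral_enorm_sq_lt_top f).ne ?_
      · refine Eventually.of_forall fun x => ?_
        by_cases hx : x ∈ S n <;> simp [hx]
      · refine Eventually.of_forall fun x => ?_
        obtain ⟨N, hN⟩ := exists_nat_ge ‖hM.mk M x‖
        refine tendsto_const_nhds.congr' ?_
        filter_upwards [eventually_ge_atTop N] with n hn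
        have hx : x ∈ S n := hN.trans (by exact_mod_cast hn)
        simp [hx]
    rw [lintegral_zero] at hsq
    have h2 := hsq.ennrpow_const (2 : ℝ)⁻¹
    rw [ENNReal.zero_rpow_of_pos (by norm_num)] at h2
    refine h2.congr fun n => ?_
    rw [← eLpNorm_two_sq, ← ENNReal.rpow_two, ← ENNReal.rpow_mul]
    norm_num
  rw [Lp.toLp_coeFn] at hlim
  exact mem_closure_of_tendsto hlim (Eventually.of_forall hdom)

end Multiplication

/-! ### The polar decomposition -/

section Polar

/-- On a finite spectrum every function is continuous, so `cfc` of `t⁻¹` is the genuine functional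
calculus even when `0` is in the spectrum, not the default value. -/
lemma finite_real_spectrum (T : Spinor →L[ℂ] Spinor) : (spectrum ℝ T).Finite := by
  obtain ⟨A, rfl⟩ := (Matrix.toEuclideanCLM (n := Fin 2) (𝕜 := ℂ)).surjective T
  have e := AlgEquiv.spectrum_eq
    ((Matrix.toEuclideanCLM (n := Fin 2) (𝕜 := ℂ)).toAlgEquiv.restrictScalars ℝ) A
  exact e ▸ A.finite_real_spectrum

lemma continuousOn_real_spectrum (f : ℝ → ℝ) (T : Spinor →L[ℂ] Spinor) :
    ContinuousOn f (spectrum ℝ T) :=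
  (finite_real_spectrum T).continuousOn f

lemma enorm_sqrtAbs_sq (T : Spinor →L[ℂ] Spinor) : ‖sqrtAbs T‖ₑ ^ 2 = ‖T‖ₑ := by
  have h : ‖sqrtAbs T‖ ^ 2 = ‖T‖ := by
    rw [sqrtAbs, CFC.norm_sqrt _ (CFC.abs_nonneg T), Real.sq_sqrt (norm_nonneg _), CFC.norm_abs]
  rw [← ofReal_norm, ← ENNReal.ofReal_pow (norm_nonneg _), h, ofReal_norm]

/-- `U* U = |T|⁻¹ |T|² |T|⁻¹` is the functional calculus of a function with values `0` and `1` only,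
and `‖U‖² = ‖U* U‖`. -/
lemma norm_polarPart_le_one (T : Spinor →L[ℂ] Spinor) : ‖polarPart T‖ ≤ 1 := by
  set a := CFC.abs T with ha
  have hsa : IsSelfAdjoint a := (CFC.abs_nonneg T).isSelfAdjoint
  set g := cfc (fun t : ℝ => t⁻¹) a with hg
  have hgsa : IsSelfAdjoint g := cfc_predicate _ _
  have hid : cfc (fun t : ℝ => t) a = a := cfc_id' ℝ a
  have hc := fun f : ℝ → ℝ => continuousOn_real_spectrum f a
  have e : star (polarPart T) * polarPart T = cfc (fun t : ℝ => t⁻¹ * (t * t) * t⁻¹) a := by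
    calc star (polarPart T) * polarPart T = g * (star T * T) * g := by
          rw [polarPart, ← ha, ← hg, star_mul, hgsa.star_eq]
          simp only [mul_assoc]
      _ = g * (a * a) * g := by rw [ha, CFC.abs_mul_abs]
      _ = _ := by
          rw [cfc_mul _ _ a (hc _) (hc _), cfc_mul _ _ a (hc _) (hc _),
            cfc_mul _ _ a (hc _) (hc _), hid]
  have h1 : ‖polarPart T‖ * ‖polarPart T‖ ≤ 1 := by
    rw [← CStarRing.norm_star_mul_self, e]
    refine norm_cfc_le zero_le_one fun t _ => ?_
    by_cases ht : t = 0
    · simp [ht]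
    · have : t⁻¹ * (t * t) * t⁻¹ = 1 := by field_simp
      rw [this, norm_one]
  nlinarith [norm_nonneg (polarPart T)]

lemma enorm_polarPart_mul_sqrtAbs_sq_le (T : Spinor →L[ℂ] Spinor) :
    ‖polarPart T * sqrtAbs T‖ₑ ^ 2 ≤ ‖T‖ₑ := by
  rw [← enorm_sqrtAbs_sq T]
  refine pow_le_pow_left' (enorm_le_iff_norm_le.2 ?_) 2
  exact (norm_mul_le _ _).trans
    (mul_le_of_le_one_left (norm_nonneg _) (norm_polarPart_le_one T))

lemma continuous_sqrtAbs : Continuous sqrtAbs :=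
  CFC.continuousOn_sqrt.comp_continuous CFC.continuous_abs fun T => CFC.abs_nonneg T

/-- The polar part need not be continuous where the rank drops, but it is a pointwise limit of
continuous maps: `t / (t² + 1/(n+1))` tends to `t⁻¹` for every `t`, including `0⁻¹ = 0`, and the
convergence is uniform on a finite spectrum. -/
lemma stronglyMeasurable_polarPart : StronglyMeasurable polarPart := by
  let G : ℕ → ℝ → ℝ := fun n t => t / (t ^ 2 + ((n : ℝ) + 1)⁻¹)
  have hpos : ∀ (n : ℕ) (t : ℝ), 0 < t ^ 2 + ((n : ℝ) + 1)⁻¹ := fun n t => by positivity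
  have hG : ∀ n, Continuous (G n) := fun n =>
    continuous_id.div (by fun_prop) fun t => (hpos n t).ne'
  have hlim : ∀ t, Tendsto (fun n => G n t) atTop (𝓝 t⁻¹) := by
    intro t
    by_cases ht : t = 0
    · simp [G, ht]
    · have h1 : Tendsto (fun n : ℕ => ((n : ℝ) + 1)⁻¹) atTop (𝓝 0) := by
        simpa [one_div] using tendsto_one_div_add_atTop_nhds_zero_nat (𝕜 := ℝ)
      have h2 : Tendsto (fun n : ℕ => t / (t ^ 2 + ((n : ℝ) + 1)⁻¹)) atTop (𝓝 (t / (t ^ 2 + 0))) :=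
        tendsto_const_nhds.div (tendsto_const_nhds.add h1) (by positivity)
      have e : t / (t ^ 2 + 0) = t⁻¹ := by field_simp; simp
      rwa [e] at h2
  refine stronglyMeasurable_of_tendsto (u := atTop)
    (f := fun (n : ℕ) (T : Spinor →L[ℂ] Spinor) => T * cfc (G n) (CFC.abs T)) (fun n => ?_) ?_
  · refine Continuous.stronglyMeasurable (continuous_id.mul ?_)
    exact Continuous.cfc_of_mem_nhdsSet (s := univ) (G n) (by simp) CFC.continuous_abs
      (fun T => (CFC.abs_nonneg T).isSelfAdjoint) (hG n).continuousOn
  · rw [tendsto_pi_nhds]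
    intro T
    refine tendsto_const_nhds.mul (tendsto_cfc_fun ?_
      (Eventually.of_forall fun n => (hG n).continuousOn))
    rw [Metric.tendstoUniformlyOn_iff]
    intro ε hε
    refine (finite_real_spectrum (CFC.abs T)).eventually_all.2 fun t _ => ?_
    filter_upwards [(Metric.tendsto_nhds.1 (hlim t)) ε hε] with n hn
    rwa [dist_comm]

end Polar

/-! ### The potential -/

section Potential

variable {V : ℝ → Matrix (Fin 2) (Fin 2) ℂ}

lemma aestronglyMeasurable_matOp (hV : ∀ i j, MemL1AddLinftyZero (fun x => V x i j)) :
    AEStronglyMeasurable (fun x => matOp (V x)) volume := by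
  have hij : ∀ i j, AEStronglyMeasurable (fun x => V x i j) volume := by
    intro i j
    obtain ⟨w, g, hw, hg, he⟩ := hV i j
    exact (hw.1.add hg.1.1).congr he.symm
  have e : ∀ x, matOp (V x) = ∑ i, ∑ j, V x i j • matOp (Matrix.single i j 1) := by
    intro x
    conv_lhs => rw [Matrix.matrix_eq_sum_single (V x)]
    simp only [matOp, map_sum, ← map_smul, Matrix.smul_single, smul_eq_mul, mul_one]
  simp only [e]
  exact Finset.aestronglyMeasurable_fun_sum _ fun i _ =>
    Finset.aestronglyMeasurable_fun_sum _ fun j _ => (hij i j).smul_const _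

lemma isExpBounded_of_enorm_sq_le {a : ℝ → Spinor →L[ℂ] Spinor} {s : ℝ}
    (ha : AEStronglyMeasurable a volume) (hle : ∀ x, ‖a x‖ₑ ^ 2 ≤ ‖matOp (V x)‖ₑ)
    (hF : FV V s ≠ ⊤) : IsExpBounded a s (FV V s).toNNReal where
  meas := ha
  bound := by
    intro y
    rw [ENNReal.coe_toNNReal hF]
    exact (lintegral_mono fun x => mul_le_mul_left (hle x) _).trans
      (le_iSup (fun y : ℝ => ∫⁻ x : ℝ, ‖matOp (V x)‖ₑ *
        ENNReal.ofReal (Real.exp (-s * |x - y|))) y)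

/-- If the weighted constants of `A` and `B` are small, then the perturbed resolvent exists. -/
theorem exists_isPerturbedResolvent {m : ℝ} {z k : ℂ} (hk : 0 < k.im)
    (hkz : k ^ 2 = z ^ 2 - (m : ℂ) ^ 2) {A B : ℝ → Spinor →L[ℂ] Spinor} {Ca Cb : ℝ≥0}
    (hA : IsExpBounded A k.im Ca) (hB : IsExpBounded B k.im Cb)
    (hlt : eta ‖Phi m z‖ * Real.sqrt (Ca * Cb) < 1) :
    ∃ R, IsPerturbedResolvent (freeDirac m) (mulOp A) (mulOp B) z R := by
  have hN := isExpKernel_greenKernel hk hkz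
  obtain ⟨C, hC⟩ := exists_isExpBounded_one hk
  -- All four operators come from the same kernel, with the weights `(1, 1)`, `(A, 1)`, `(1, B)` and
  -- `(A, B)`. Only for the last does the size of the norm matter.
  obtain ⟨R₀, hR₀, -⟩ := hN.exists_operator hC hC
  obtain ⟨AR, hAR, -⟩ := hN.exists_operator hA hC
  obtain ⟨RB, hRB, -⟩ := hN.exists_operator hC hB
  obtain ⟨Q, hQ, hQn⟩ := hN.exists_operator hA hB
  rw [Real.coe_toNNReal _ (eta_pos (norm_nonneg _)).le] at hQn
  have hgA : ∀ f, (R₀ f, AR f) ∈ (mulOp A).graph := by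
    intro f
    rw [mem_graph_mulOp]
    filter_upwards [hR₀ f, hAR f] with x h1 h2
    rw [h1, h2]
    rfl
  have hker : ∀ f g, (f, g) ∈ (mulOp B).graph → ∀ x,
      kerInt (greenKernel m z k) (fun _ => 1) g x = kerInt (greenKernel m z k) B f x := by
    intro f g hfg x
    rw [mem_graph_mulOp] at hfg
    refine integral_congr_ae ?_
    filter_upwards [hfg] with y hy
    rw [hy]
    rfl
  have hRBg : ∀ f g, (f, g) ∈ (mulOp B).graph → RB f = R₀ g := by
    intro f g hfg
    refine Lp.ext ?_
    filter_upwards [hRB f, hR₀ g] with x h1 h2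
    rw [h1, h2, hker f g hfg]
  have hQg : ∀ f g, (f, g) ∈ (mulOp B).graph → Q f = AR g := by
    intro f g hfg
    refine Lp.ext ?_
    filter_upwards [hQ f, hAR g] with x h1 h2
    rw [h1, h2, hker f g hfg]
  have hdense := dense_domain_mulOp hB.meas
  refine ⟨_, R₀, AR, RB, Q, isResolventAt_freeDirac hk hkz hR₀, ?_, ?_, ?_, ?_, rfl⟩
  · apply LinearPMap.eq_of_eq_graph
    ext ⟨f, g⟩
    rw [mem_graph_prodOp, mem_graph_everywhere]
    constructor
    · rintro ⟨h, hfh, hhg⟩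
      rw [mem_graph_everywhere] at hfh
      subst hfh
      exact (mulOp A).mem_graph_snd_inj (hgA f) hhg rfl
    · rintro rfl
      exact ⟨R₀ f, (mem_graph_everywhere _ _ _).2 rfl, hgA f⟩
  · refine closure_eq_everywhere ?_ ?_
    · intro f h hfh
      obtain ⟨g, hfg, hgh⟩ := (mem_graph_prodOp _ _ _ _).1 hfh
      rw [hRBg f g hfg]
      exact (mem_graph_everywhere _ _ _).1 hgh
    · refine hdense.mono fun f hf => ?_
      obtain ⟨g, hg⟩ := (mem_domain_iff_mem_graph _ _).1 hf
      exact (mem_domain_iff_mem_graph _ _).2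
        ⟨_, (mem_graph_prodOp _ _ _ _).2 ⟨g, hg, (mem_graph_everywhere _ _ _).2 rfl⟩⟩
  · refine closure_eq_everywhere ?_ ?_
    · intro f h hfh
      obtain ⟨l, hfl, hlh⟩ := (mem_graph_prodOp _ _ _ _).1 hfh
      obtain ⟨g, hfg, hgl⟩ := (mem_graph_prodOp _ _ _ _).1 hfl
      rw [hQg f g hfg]
      rw [mem_graph_everywhere] at hgl
      exact (mulOp A).mem_graph_snd_inj (hgA g) hlh hgl
    · refine hdense.mono fun f hf => ?_
      obtain ⟨g, hg⟩ := (mem_domain_iff_mem_graph _ _).1 hf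
      exact (mem_domain_iff_mem_graph _ _).2 ⟨_, (mem_graph_prodOp _ _ _ _).2
        ⟨_, (mem_graph_prodOp _ _ _ _).2 ⟨g, hg, (mem_graph_everywhere _ _ _).2 rfl⟩, hgA g⟩⟩
  · refine spectrum.mem_resolventSet_of_norm_lt_mul ?_
    rw [norm_neg, norm_one (α := ℂ)]
    exact (mul_le_of_le_one_right (norm_nonneg _) ContinuousLinearMap.norm_id_le).trans_lt
      (hQn.trans_lt hlt)

/-- The spectral estimate for the perturbed Dirac operator. -/
theorem notMem_sigma_diracOp {m : ℝ} {z : ℂ}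
    (hV : ∀ i j : Fin 2, MemL1AddLinftyZero (fun x => V x i j))
    (hz : z ∉ freeSpectrum m)
    (hlt : ENNReal.ofReal (eta ‖Phi m z‖) * FV V (sqrtUpper (z ^ 2 - (m : ℂ) ^ 2)).im < 1) :
    z ∉ sigma (diracOp m V) := by
  set k := sqrtUpper (z ^ 2 - (m : ℂ) ^ 2) with hkdef
  have hkz : k ^ 2 = z ^ 2 - (m : ℂ) ^ 2 := sqrtUpper_sq _
  have hk : 0 < k.im := by
    -- If `z² - m² = t ≥ 0`, then `z = ±√(m² + t)` is real with `|z| ≥ m`, hence in the free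
    -- spectrum.
    refine sqrtUpper_im_pos fun t ht h => hz ?_
    have hz2 : z ^ 2 = ((Real.sqrt (m ^ 2 + t) : ℝ) : ℂ) ^ 2 := by
      rw [← Complex.ofReal_pow, Real.sq_sqrt (by positivity)]
      push_cast
      linear_combination h
    have hm : |m| ≤ Real.sqrt (m ^ 2 + t) := Real.abs_le_sqrt (by linarith)
    have hm1 := le_abs_self m
    rcases sq_eq_sq_iff_eq_or_eq_neg.1 hz2 with h1 | h1
    · exact ⟨Real.sqrt (m ^ 2 + t), Or.inr (mem_Ici.2 (hm1.trans hm)), h1.symm⟩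
    · refine ⟨-Real.sqrt (m ^ 2 + t), Or.inl (mem_Iic.2 (by linarith)), ?_⟩
      rw [h1]
      push_cast
      rfl
  have heta := eta_pos (norm_nonneg (Phi m z))
  -- As `η > 0`, an infinite `F_V` would make the product infinite.
  have hF : FV V k.im ≠ ⊤ := by
    intro h
    rw [h, ENNReal.mul_top (by simpa using heta)] at hlt
    simp at hlt
  have hmeas := aestronglyMeasurable_matOp hV
  have hA : IsExpBounded (fun x => sqrtAbs (matOp (V x))) k.im (FV V k.im).toNNReal :=
    isExpBounded_of_enorm_sq_le (continuous_sqrtAbs.comp_aestronglyMeasurable hmeas)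
      (fun x => (enorm_sqrtAbs_sq _).le) hF
  have hB : IsExpBounded (fun x => polarPart (matOp (V x)) * sqrtAbs (matOp (V x))) k.im
      (FV V k.im).toNNReal :=
    isExpBounded_of_enorm_sq_le
      ((stronglyMeasurable_polarPart.mul
        continuous_sqrtAbs.stronglyMeasurable).aestronglyMeasurable.comp_aemeasurable hmeas.aemeasurable)
      (fun x => enorm_polarPart_mul_sqrtAbs_sq_le _) hF
  have hlt' : eta ‖Phi m z‖ * Real.sqrt ((FV V k.im).toNNReal * (FV V k.im).toNNReal) < 1 := by
    rw [Real.sqrt_mul_self NNReal.zero_le_coe]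
    have h := (ENNReal.toReal_lt_toReal (hlt.trans ENNReal.one_lt_top).ne ENNReal.one_ne_top).2 hlt
    rwa [ENNReal.toReal_mul, ENNReal.toReal_ofReal heta.le, ENNReal.toReal_one] at h
  obtain ⟨R, hR⟩ := exists_isPerturbedResolvent hk hkz hA hB hlt'
  exact fun h => h (mem_rho_perturbedOp isClosed_mulOp hR)

/-! ### Monotonicity of `F_V` and real spectral parameters in the gap. -/

lemma antitone_FV (V : ℝ → Matrix (Fin 2) (Fin 2) ℂ) : Antitone (FV V) := by
  intro s t hst
  refine iSup_mono fun y => lintegral_mono fun x => mul_le_mul_right ?_ _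
  refine ENNReal.ofReal_le_ofReal (Real.exp_le_exp.2 ?_)
  have := mul_le_mul_of_nonneg_right hst (abs_nonneg (x - y))
  linarith

lemma eta_norm_Phi_ofReal {m x : ℝ} (hx : |x| < m) :
    eta ‖Phi m x‖ = m / Real.sqrt (m ^ 2 - x ^ 2) := by
  obtain ⟨h1, h2⟩ := abs_lt.1 hx
  have hm : 0 < m := (abs_nonneg x).trans_lt hx
  have h3 : 0 < m - x := by linarith
  have h4 : 0 < x + m := by linarith
  have hΦ : ‖Phi m x‖ = (x + m) / (m - x) := by
    rw [Phi, norm_div, ← Complex.ofReal_add, ← Complex.ofReal_sub, Complex.norm_real,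
      Complex.norm_real, Real.norm_of_nonneg h4.le, Real.norm_eq_abs, abs_sub_comm, abs_of_pos h3]
  have e : 1 / 2 + ((x + m) / (m - x) + ((x + m) / (m - x))⁻¹) / 4 = m ^ 2 / (m ^ 2 - x ^ 2) := by
    have h5 : m ^ 2 - x ^ 2 = (m - x) * (x + m) := by ring
    rw [h5]
    field_simp
    ring
  rw [hΦ, eta, e, Real.sqrt_div (sq_nonneg m), Real.sqrt_sq hm.le]

lemma sqrtUpper_im_ofReal {m x : ℝ} (hx : |x| < m) :
    (sqrtUpper ((x : ℂ) ^ 2 - (m : ℂ) ^ 2)).im = Real.sqrt (m ^ 2 - x ^ 2) := by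
  have h0 : 0 < m ^ 2 - x ^ 2 := by
    have := sq_lt_sq' (abs_lt.1 hx).1 (abs_lt.1 hx).2
    linarith
  have e : -((x : ℂ) ^ 2 - (m : ℂ) ^ 2) = ((m ^ 2 - x ^ 2 : ℝ) : ℂ) := by push_cast; ring
  have e' : (1 / 2 : ℂ) = ((1 / 2 : ℝ) : ℂ) := by norm_num
  rw [sqrtUpper, e, e', ← Complex.ofReal_cpow h0.le, ← Real.sqrt_eq_rpow]
  simp

end Potential

end DiracSpectrum

end

theorem mainTheorem5 (m : ℝ) (hm : 0 ≤ m)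
    (V : ℝ → Matrix (Fin 2) (Fin 2) ℂ)
    (hV : ∀ i j : Fin 2, DiracSpectrum.MemL1AddLinftyZero (fun x => V x i j)) :
    (∀ z : ℂ, z ∉ DiracSpectrum.freeSpectrum m →
      ENNReal.ofReal (DiracSpectrum.eta ‖DiracSpectrum.Phi m z‖) *
          DiracSpectrum.FV V (DiracSpectrum.sqrtUpper (z ^ 2 - (m : ℂ) ^ 2)).im < 1 →
      z ∉ DiracSpectrum.sigma (DiracSpectrum.diracOp m V)) ∧
    (∀ μ₀ : ℝ, μ₀ ∈ Set.Ioo (-m) m →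
      (DiracSpectrum.FV V μ₀ : EReal) = ((μ₀ / m : ℝ) : EReal) →
      (∀ μ : ℝ, (DiracSpectrum.FV V μ : EReal) = ((μ / m : ℝ) : EReal) → μ = μ₀) ∧
      DiracSpectrum.sigma (DiracSpectrum.diracOp m V) ∩
        Complex.ofReal '' Set.Ioo (-Real.sqrt (m ^ 2 - μ₀ ^ 2)) (Real.sqrt (m ^ 2 - μ₀ ^ 2)) =
          ∅) := by
  refine ⟨fun z hz hlt => DiracSpectrum.notMem_sigma_diracOp hV hz hlt, fun μ₀ hμ₀ hF => ?_⟩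
  -- The interval `(-m, m)` contains `μ₀`, which excludes `m = 0` and with it a division by zero.
  have hm0 : 0 < m := by linarith [hμ₀.1, hμ₀.2]
  -- For solutions `s ≤ t`, monotonicity gives `t/m = F_V(t) ≤ F_V(s) = s/m`, hence uniqueness.
  have hle : ∀ s t : ℝ, (DiracSpectrum.FV V s : EReal) = ((s / m : ℝ) : EReal) →
      (DiracSpectrum.FV V t : EReal) = ((t / m : ℝ) : EReal) → s ≤ t → t ≤ s := by
    intro s t hs ht hst
    have h : (DiracSpectrum.FV V t : EReal) ≤ (DiracSpectrum.FV V s : EReal) :=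
      EReal.coe_ennreal_le_coe_ennreal_iff.2 (DiracSpectrum.antitone_FV V hst)
    rw [hs, ht, EReal.coe_le_coe_iff] at h
    exact (div_le_div_iff_of_pos_right hm0).1 h
  refine ⟨fun μ hμ => ?_, ?_⟩
  · rcases le_total μ μ₀ with h | h
    · exact le_antisymm h (hle _ _ hμ hF h)
    · exact le_antisymm (hle _ _ hF hμ h) h
  -- The equation is read in the extended reals, where `F_V ≥ 0` forces the sign of `μ₀`.
  have hμ0 : 0 ≤ μ₀ := by
    have h : (0 : EReal) ≤ ((μ₀ / m : ℝ) : EReal) := hF ▸ EReal.coe_ennreal_nonneg _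
    have h' : 0 ≤ μ₀ / m := by exact_mod_cast h
    by_contra hneg
    exact absurd h' (not_le.2 (div_neg_of_neg_of_pos (not_le.1 hneg) hm0))
  have hF' : DiracSpectrum.FV V μ₀ = ENNReal.ofReal (μ₀ / m) := by
    rw [← EReal.coe_ennreal_eq_coe_ennreal_iff, hF, EReal.coe_ennreal_ofReal,
      max_eq_left (div_nonneg hμ0 hm0.le)]
  rw [Set.eq_empty_iff_forall_notMem]
  rintro _ ⟨hσ, x, hx, rfl⟩
  have hx2 : x ^ 2 < m ^ 2 - μ₀ ^ 2 := Real.sq_lt.2 hx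
  have hxm : |x| < m := abs_lt_of_sq_lt_sq (by nlinarith [sq_nonneg μ₀]) hm
  have hlt : μ₀ < Real.sqrt (m ^ 2 - x ^ 2) := Real.lt_sqrt_of_sq_lt (by linarith)
  have hspos : 0 < Real.sqrt (m ^ 2 - x ^ 2) := hμ0.trans_lt hlt
  refine DiracSpectrum.notMem_sigma_diracOp hV ?_ ?_ hσ
  · rintro ⟨t, ht, he⟩
    obtain rfl : t = x := Complex.ofReal_injective he
    obtain ⟨h1, h2⟩ := abs_lt.1 hxm
    rcases ht with ht | ht
    · exact absurd h1 (not_lt.2 ht)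
    · exact absurd h2 (not_lt.2 ht)
  · rw [DiracSpectrum.eta_norm_Phi_ofReal hxm, DiracSpectrum.sqrtUpper_im_ofReal hxm]
    -- With `s = √(m² - x²) > μ₀`: `(m/s) F_V(s) ≤ (m/s)(μ₀/m) = μ₀/s < 1`.
    calc _ ≤ ENNReal.ofReal (m / Real.sqrt (m ^ 2 - x ^ 2)) * DiracSpectrum.FV V μ₀ :=
          mul_le_mul_right (DiracSpectrum.antitone_FV V hlt.le) _
      _ = ENNReal.ofReal (μ₀ / Real.sqrt (m ^ 2 - x ^ 2)) := by
          rw [hF', ← ENNReal.ofReal_mul (by positivity)]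
          congr 1
          field_simp
      _ < 1 := ENNReal.ofReal_lt_one.2 ((div_lt_one hspos).2 hlt)
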